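/- Let $\mathbb{D}^\infty$ be the open unit ball of the complex Banach space $\ell_\infty$ of bounded complex sequences, and let $H_\infty(\mathbb{D}^\infty)$ be the set of all bounded Fréchet complex-differentiable functions $f:\mathbb{D}^\infty\to\mathbb{C}$. For a multi-index $\alpha\in\mathbb{N}_0^{(\mathbb{N})}$ (a finitely supported sequence of non-negative integers) with $\alpha\in\mathbb{N}_0^k$, the monomial coefficient of $f$ is $$c_\alpha(f)=\frac{1}{(2\pi i)^k}\int_{|w_1|=r}\cdots\int_{|w_k|=r}\frac{f(w_1,\dots,w_k,0,0,\dots)}{w^{\alpha+1}}\,dw_1\cdots dw_k ,\qquad 0<r<1,$$ which depends neither on $r$ nor on the choice of $k$. Let $\operatorname{mon} H_\infty(\mathbb{D}^\infty)$ be the set of all $z\in\mathbb{D}^\infty$ such that for every $f\in H_\infty(\mathbb{D}^\infty)$ the series $\sum_{\alpha\in\mathbb{N}_0^{(\mathbb{N})}}c_\alpha(f)z^\alpha$ converges absolutely and has sum $f(z)$. For $z\in\ell_\infty$ let $$z^*_n=\inf\Big\{\sup_{j\in\mathbb{N}\setminus J}|z_j| : J\subseteq\mathbb{N},\ \operatorname{card}(J)<n\Big\},\qquad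 n\ge 1,$$ be its decreasing rearrangement. **Theorem.** Let $z\in\mathbb{D}^\infty$. 1. If $\displaystyle\limsup_{n\to\infty}\frac{1}{\log n}\sum_{j=1}^n (z^*_j)^2<\frac12$, then $z\in\operatorname{mon}H_\infty(\mathbb{D}^\infty)$. 2. If $z\in\operatorname{mon}H_\infty(\mathbb{D}^\infty)$, then $\displaystyle\limsup_{n\to\infty}\frac{1}{\log n}\sum_{j=1}^n (z^*_j)^2\le 1$. Here the limit superior is taken in $[-\infty,\infty]$. -/

import Mathlib

open scoped ENNReal

noncomputable section

namespace MonConv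

/-- The complex Banach space `ℓ_∞` of bounded complex sequences with the supremum norm.
The coordinates are indexed by `0, 1, 2, …`. -/
abbrev Linf : Type := lp (fun _ : ℕ => ℂ) ∞

/-- The open unit ball of `ℓ_∞`, the infinite dimensional polydisk. -/
def polydisk : Set Linf := Metric.ball 0 1

/-- `f` (only its values on the polydisk matter) belongs to `H_∞` of the polydisk:
it is Fréchet complex differentiable and bounded there. -/
def IsHInfty (f : Linf → ℂ) : Prop :=
  DifferentiableOn ℂ f polydisk ∧ ∃ C : ℝ, ∀ z ∈ polydisk, ‖f z‖ ≤ C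

/-- The inclusion of `ℂ^k` into `ℓ_∞`, filling up with zeros: `(w, 0, 0, …)`. -/
def embed (k : ℕ) (w : Fin k → ℂ) : Linf :=
  ∑ i : Fin k, lp.single ∞ (i : ℕ) (w i)

/-- The Cauchy integral
`(2πi)^{-k} ∫_{|w_1| = r} ⋯ ∫_{|w_k| = r} f(w) / w^{α+1} dw_1 ⋯ dw_k`, with `r = 1/2`, for the
restriction of `f` to `ℂ^k`; for holomorphic `f` the value does not depend on `0 < r < 1`. -/
def cauchyCoeff (k : ℕ) (f : Linf → ℂ) (α : ℕ →₀ ℕ) : ℂ :=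
  ((2 * (Real.pi : ℂ) * Complex.I) ^ k)⁻¹ *
    torusIntegral (fun w : Fin k → ℂ => f (embed k w) / ∏ i : Fin k, w i ^ (α (i : ℕ) + 1))
      0 (fun _ => 1 / 2)

/-- The smallest `k` such that `α j = 0` for all `j ≥ k`. -/
def length (α : ℕ →₀ ℕ) : ℕ := α.support.sup Nat.succ

/-- The monomial coefficient `c_α(f)`. -/
def monomialCoeff (f : Linf → ℂ) (α : ℕ →₀ ℕ) : ℂ := cauchyCoeff (length α) f α

/-- The monomial `z^α = ∏_j z_j^{α_j}`. -/
def monomial (z : Linf) (α : ℕ →₀ ℕ) : ℂ := α.prod fun j m => (z j) ^ m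

/-- The set of monomial convergence of `H_∞` of the polydisk: the points `z` at which, for every
`f`, the monomial series expansion of `f` converges absolutely, with sum `f z`. -/
def monHInfty : Set Linf :=
  {z | z ∈ polydisk ∧ ∀ f : Linf → ℂ, IsHInfty f →
    Summable (fun α : ℕ →₀ ℕ => ‖monomialCoeff f α * monomial z α‖) ∧
    HasSum (fun α : ℕ →₀ ℕ => monomialCoeff f α * monomial z α) (f z)}

/-- The decreasing rearrangement
`z*_n = inf { sup_{j ∉ J} |z_j| : J ⊆ ℕ, card J < n }`, for `n = 1, 2, 3, …`
(the value at `n = 0` is not used). -/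
def decRearr (z : Linf) (n : ℕ) : ℝ :=
  sInf {t : ℝ | ∃ J : Finset ℕ, J.card < n ∧ t = ⨆ j : {j : ℕ // j ∉ J}, ‖z j‖}

/-- `limsup_{n → ∞} (1 / log n) ∑_{j=1}^n (z*_j)^2`, as an extended real number. -/
def logLimsup (z : Linf) : EReal :=
  Filter.limsup
    (fun n : ℕ => ((1 / Real.log n * ∑ j ∈ Finset.Icc 1 n, decRearr z j ^ 2 : ℝ) : EReal))
    Filter.atTop

end MonConv

end

noncomputable section

namespace MonConv

open Real Metric

/-! ### One-variable Carleman inequality by Hardy space factorisation. -/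

section Carleman

open Polynomial

/-! Sufficiency. The core is an estimate, uniform in the number of variables, for a polynomial `P =
∑ a_α w^α` with `|P| ≤ C` on the polydisk. For `t < 1` a Cauchy estimate along one complex line
bounds the sum over `k` of the moduli of the Euler derivatives `w_k ∂_k P` at `t w` by `C t / (1 -
t)` (`sum_norm_euler_le`). Carleman's inequality on the torus (`carleman_torus`) bounds an `ℓ²` norm
of coefficients with weights `∏ (α_j + 1)⁻¹` by the `L¹` norm; applied to each Euler derivative, it
gives numbers `A_k` with `∑ A_k ≤ C t / (1 - t)`. A nonzero `α` is assigned to an index `k` of its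
support at which `|z_k|` is smallest. Cauchy–Schwarz on the class of `k` then costs a factor of
order `|z_k| ∏ (1 - |z_j|² / t²)⁻¹`, the product over the `j` with `|z_j| ≥ |z_k|`
(`sum_norm_mul_prod_le`). If `m` such indices occur, then `∑ |z_j|² ≤ L log m` over them, so `|z_k|
≤ √(L log m / m)`, while the product is at most a constant times `m ^ (c L / t²)`. Since `L < 1/2`,
one can take `c > 1` and `t < 1` so close to `1` that the exponent is below `1/2`; the factor is
then bounded (`exists_prod_bound`). Truncated dilations of `f` carry the estimate over to `f`. The
sum is `f z` because `z` tends to zero, so that its truncations converge to it in norm.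

Necessity. If the limit superior exceeds `1`, then for some `b > 1` and infinitely many `n` there
are `n` coordinates with `exp (∑ |z_j|²) ≥ n^b`. Random signs on the coefficients `|z|^α`, with all
`α_i ≤ 2`, give a polynomial whose supremum is `O(√(V n log n))`, where `V = ∑ |z^α|² ≥ n^b` is also
its absolute sum at `z`. The ratio is unbounded (`exists_polynomial_sum_norm_ge`). Such polynomials,
multiplied by `2^{-k} z_l^{3k}` so that no two share a monomial, add up to one bounded holomorphic
function whose series is not absolutely convergent at `z`. -/

theorem continuous_circleIntegrable {E : Type*} [NormedAddCommGroup E] {f : ℂ → E}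
    (hf : Continuous f) (c : ℂ) (R : ℝ) : CircleIntegrable f c R :=
  ContinuousOn.circleIntegrable' hf.continuousOn

theorem sum_range_sq_norm_coeff_le (p : ℂ[X]) (N : ℕ) :
    ∑ k ∈ Finset.range N, ‖p.coeff k‖ ^ 2 ≤ circleAverage (fun w => ‖p.eval w‖ ^ 2) 0 1 := by
  rw [← p.sum_sq_norm_coeff_eq_circleAverage]
  calc ∑ k ∈ Finset.range N, ‖p.coeff k‖ ^ 2
      ≤ ∑ k ∈ Finset.range N ∪ p.support, ‖p.coeff k‖ ^ 2 :=
        Finset.sum_le_sum_of_subset_of_nonneg Finset.subset_union_left fun _ _ _ => by positivity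
    _ = ∑ k ∈ p.support, ‖p.coeff k‖ ^ 2 := by
        symm
        refine Finset.sum_subset Finset.subset_union_right fun k _ hk => ?_
        simp [Polynomial.notMem_support_iff.1 hk]

/-- The coefficient inequality behind Carleman's inequality, for a product of polynomials. -/
theorem sum_sq_norm_coeff_mul_le (G H : ℂ[X]) (N : ℕ) :
    ∑ k ∈ Finset.range N, ‖(G * H).coeff k‖ ^ 2 / (k + 1) ≤
      circleAverage (fun w => ‖G.eval w‖ ^ 2) 0 1 *
        circleAverage (fun w => ‖H.eval w‖ ^ 2) 0 1 := by
  -- Cauchy–Schwarz on the convolution, which has `k + 1` terms: this is where the weight comes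
  -- from.
  have h1 : ∀ k ∈ Finset.range N, ‖(G * H).coeff k‖ ^ 2 / (k + 1) ≤
      ∑ x ∈ Finset.HasAntidiagonal.antidiagonal k, ‖G.coeff x.1‖ ^ 2 * ‖H.coeff x.2‖ ^ 2 := by
    intro k _
    rw [div_le_iff₀ (by positivity), Polynomial.coeff_mul]
    calc ‖∑ x ∈ Finset.HasAntidiagonal.antidiagonal k, G.coeff x.1 * H.coeff x.2‖ ^ 2
        ≤ (∑ x ∈ Finset.HasAntidiagonal.antidiagonal k, ‖G.coeff x.1 * H.coeff x.2‖) ^ 2 := by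
          gcongr
          exact norm_sum_le _ _
      _ ≤ (Finset.HasAntidiagonal.antidiagonal k).card *
            ∑ x ∈ Finset.HasAntidiagonal.antidiagonal k, ‖G.coeff x.1 * H.coeff x.2‖ ^ 2 :=
          sq_sum_le_card_mul_sum_sq
      _ = _ := by
          simp only [norm_mul, mul_pow, Finset.Nat.card_antidiagonal]
          push_cast
          ring
  calc ∑ k ∈ Finset.range N, ‖(G * H).coeff k‖ ^ 2 / (k + 1)
      ≤ ∑ k ∈ Finset.range N, ∑ x ∈ Finset.HasAntidiagonal.antidiagonal k,
          ‖G.coeff x.1‖ ^ 2 * ‖H.coeff x.2‖ ^ 2 := Finset.sum_le_sum h1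
    _ = ∑ x ∈ (Finset.range N).sigma fun k => Finset.HasAntidiagonal.antidiagonal k,
          ‖G.coeff x.2.1‖ ^ 2 * ‖H.coeff x.2.2‖ ^ 2 := by rw [Finset.sum_sigma]
    _ ≤ ∑ x ∈ Finset.range N ×ˢ Finset.range N, ‖G.coeff x.1‖ ^ 2 * ‖H.coeff x.2‖ ^ 2 := by
        rw [← Finset.sum_image
          (s := (Finset.range N).sigma fun k => Finset.HasAntidiagonal.antidiagonal k)
          (g := fun x => x.2) (f := fun x : ℕ × ℕ => ‖G.coeff x.1‖ ^ 2 * ‖H.coeff x.2‖ ^ 2)]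
        · refine Finset.sum_le_sum_of_subset_of_nonneg ?_ fun _ _ _ => by positivity
          intro x hx
          simp only [Finset.mem_image, Finset.mem_sigma, Finset.mem_range,
            Finset.HasAntidiagonal.mem_antidiagonal] at hx
          obtain ⟨y, ⟨h1, h2⟩, rfl⟩ := hx
          simp only [Finset.mem_product, Finset.mem_range]
          omega
        · rintro ⟨k, x⟩ hx ⟨l, y⟩ hy hxy
          simp only [Finset.coe_sigma, Set.mem_sigma_iff, Finset.mem_coe,
            Finset.HasAntidiagonal.mem_antidiagonal] at hx hy hxy
          subst hxy
          obtain rfl : k = l := by omega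
          rfl
    _ = (∑ i ∈ Finset.range N, ‖G.coeff i‖ ^ 2) * ∑ j ∈ Finset.range N, ‖H.coeff j‖ ^ 2 := by
        rw [Finset.sum_mul_sum, Finset.sum_product]
    _ ≤ _ := by
        gcongr
        · exact (Finset.sum_nonneg fun _ _ => by positivity).trans (sum_range_sq_norm_coeff_le G N)
        · exact sum_range_sq_norm_coeff_le G N
        · exact sum_range_sq_norm_coeff_le H N

/-- Taylor sums converge uniformly on a disk slightly larger than radius `r`; the dilation by `r` is
absorbed into the coefficients. -/
theorem exists_polynomial_approx {g : ℂ → ℂ} (hg : DifferentiableOn ℂ g (ball 0 1))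
    {r : ℝ} (hr0 : 0 ≤ r) (hr : r < 1) {ε : ℝ} (hε : 0 < ε) :
    ∃ G : ℂ[X], ∀ w : ℂ, ‖w‖ = 1 → ‖g (r * w) - G.eval w‖ ≤ ε := by
  obtain ⟨s, hrs, hs1⟩ := exists_between hr
  obtain ⟨q, hrq, hqs⟩ := exists_between hrs
  lift s to NNReal using by linarith
  lift q to NNReal using by linarith
  have hs0 : (0 : ℝ) < s := by linarith
  have hd : DifferentiableOn ℂ g (closedBall 0 s) := hg.mono (closedBall_subset_ball hs1)
  have hps := hd.hasFPowerSeriesOnBall (by exact_mod_cast hs0)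
  have hu := hps.tendstoUniformlyOn (r' := q) (by exact_mod_cast hqs)
  obtain ⟨n, hn⟩ := (Metric.tendstoUniformlyOn_iff.1 hu ε hε).exists
  refine ⟨∑ k ∈ Finset.range n,
    Polynomial.C ((r : ℂ) ^ k * (cauchyPowerSeries g 0 s).coeff k) * Polynomial.X ^ k,
    fun w hw => ?_⟩
  have := hn (r * w) (by simpa [hw, abs_of_nonneg hr0] using hrq)
  rw [dist_eq_norm, zero_add] at this
  refine le_of_eq_of_le ?_ this.le
  congr 2
  simp only [Polynomial.eval_finsetSum, Polynomial.eval_mul, Polynomial.eval_C,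
    Polynomial.eval_pow, Polynomial.eval_X, FormalMultilinearSeries.partialSum,
    FormalMultilinearSeries.apply_eq_pow_smul_coeff, smul_eq_mul, mul_pow]
  exact Finset.sum_congr rfl fun _ _ => by ring

/-- `p` is, in the open unit disk, a product of two holomorphic functions whose squares are
dominated by a continuous function which has the modulus of `p` on the unit circle. -/
def HasHardyFactorization (p : ℂ → ℂ) : Prop :=
  ∃ (g h : ℂ → ℂ) (F : ℂ → ℝ), DifferentiableOn ℂ g (ball 0 1) ∧ DifferentiableOn ℂ h (ball 0 1) ∧
    Continuous F ∧ (∀ w ∈ ball (0 : ℂ) 1, p w = g w * h w) ∧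
    (∀ w ∈ ball (0 : ℂ) 1, ‖g w‖ ^ 2 ≤ F w) ∧ (∀ w ∈ ball (0 : ℂ) 1, ‖h w‖ ^ 2 ≤ F w) ∧
    ∀ w ∈ sphere (0 : ℂ) 1, F w = ‖p w‖

/-- Dominating functions multiply, so a polynomial can be factorised root by root. -/
theorem HasHardyFactorization.mul {p q : ℂ → ℂ} (hp : HasHardyFactorization p)
    (hq : HasHardyFactorization q) : HasHardyFactorization fun w => p w * q w := by
  obtain ⟨g, h, F, hg, hh, hF, h1, h2, h3, h4⟩ := hp
  obtain ⟨g', h', F', hg', hh', hF', h1', h2', h3', h4'⟩ := hq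
  refine ⟨g * g', h * h', F * F', hg.mul hg', hh.mul hh', hF.mul hF', ?_, ?_, ?_, ?_⟩ <;>
    intro w hw
  · simp only [h1 w hw, h1' w hw, Pi.mul_apply]
    ring
  · simp only [Pi.mul_apply, norm_mul, mul_pow]
    have := h2 w hw
    exact mul_le_mul this (h2' w hw) (by positivity) (le_trans (by positivity) this)
  · simp only [Pi.mul_apply, norm_mul, mul_pow]
    have := h3 w hw
    exact mul_le_mul this (h3' w hw) (by positivity) (le_trans (by positivity) this)
  · simp [h4 w hw, h4' w hw]

theorem hasHardyFactorization_const (c : ℂ) : HasHardyFactorization fun _ => c := by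
  obtain ⟨s, hs⟩ := IsAlgClosed.exists_pow_nat_eq c two_pos
  refine ⟨fun _ => s, fun _ => s, fun _ => ‖c‖, by fun_prop, by fun_prop, by fun_prop, ?_, ?_, ?_,
    ?_⟩ <;> simp [← hs, sq]

/-- A holomorphic square root of `1 - a w` in the unit disk. -/
theorem exists_sqrt_one_sub_mul {a : ℂ} (ha : ‖a‖ ≤ 1) :
    ∃ g : ℂ → ℂ, DifferentiableOn ℂ g (ball 0 1) ∧ ∀ w, g w ^ 2 = 1 - a * w := by
  refine ⟨fun w => (1 - a * w) ^ ((2 : ℂ)⁻¹), ?_, fun w => ?_⟩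
  · intro w hw
    refine DifferentiableAt.differentiableWithinAt ?_
    refine DifferentiableAt.cpow_const (by fun_prop) ?_
    left
    have h1 : ‖a * w‖ < 1 := by
      rw [norm_mul]
      have : ‖w‖ < 1 := by simpa using hw
      nlinarith [norm_nonneg a, norm_nonneg w]
    have := (Complex.abs_re_le_norm (a * w)).trans_lt h1
    rw [Complex.sub_re, Complex.one_re]
    linarith [le_abs_self (a * w).re]
  · exact Complex.cpow_nat_inv_pow (1 - a * w) (n := 2) two_ne_zero

/-- The difference of the squares is `(1 - |a|²)(1 - |w|²)`; a Blaschke factor is therefore bounded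
by one in the disk. -/
theorem norm_sub_le_norm_one_sub_conj_mul {a w : ℂ} (ha : ‖a‖ ≤ 1) (hw : ‖w‖ ≤ 1) :
    ‖w - a‖ ≤ ‖1 - (starRingEnd ℂ) a * w‖ := by
  refine le_of_sq_le_sq ?_ (norm_nonneg _)
  rw [← Complex.normSq_eq_norm_sq, ← Complex.normSq_eq_norm_sq]
  have ha' : Complex.normSq a ≤ 1 := by
    rw [Complex.normSq_eq_norm_sq]; nlinarith [norm_nonneg a]
  have hw' : Complex.normSq w ≤ 1 := by
    rw [Complex.normSq_eq_norm_sq]; nlinarith [norm_nonneg w]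
  have : Complex.normSq (1 - (starRingEnd ℂ) a * w) - Complex.normSq (w - a)
      = (1 - Complex.normSq a) * (1 - Complex.normSq w) := by
    simp only [Complex.normSq_apply, Complex.sub_re, Complex.sub_im, Complex.mul_re, Complex.mul_im,
      Complex.one_re, Complex.one_im, Complex.conj_re, Complex.conj_im]
    ring
  nlinarith

theorem norm_sub_eq_norm_one_sub_conj_mul {a w : ℂ} (hw : ‖w‖ = 1) :
    ‖w - a‖ = ‖1 - (starRingEnd ℂ) a * w‖ := by
  have hw' : w * (starRingEnd ℂ) w = 1 := by
    rw [Complex.mul_conj, Complex.normSq_eq_norm_sq, hw]; simp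
  have : 1 - (starRingEnd ℂ) a * w = w * (starRingEnd ℂ) (w - a) := by
    rw [map_sub, mul_sub, hw']; ring
  rw [this, norm_mul, hw, one_mul, RCLike.norm_conj]

/-- For `|a| ≤ 1`, write `w - a` as a Blaschke factor times `1 - ā w` and split the square root of
the latter. For `|a| > 1` there is no zero in the disk and `w - a` itself has a holomorphic root. -/
theorem hasHardyFactorization_sub (a : ℂ) : HasHardyFactorization fun w => w - a := by
  rcases le_or_gt ‖a‖ 1 with ha | ha
  · obtain ⟨g, hg, hg2⟩ := exists_sqrt_one_sub_mul (a := (starRingEnd ℂ) a)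
      (by rwa [RCLike.norm_conj])
    have hne : ∀ w ∈ ball (0 : ℂ) 1, 1 - (starRingEnd ℂ) a * w ≠ 0 := by
      intro w hw h0
      have h1 : ‖(starRingEnd ℂ) a * w‖ = 1 := by rw [← sub_eq_zero.1 h0]; simp
      rw [norm_mul, RCLike.norm_conj] at h1
      have : ‖w‖ < 1 := by simpa using hw
      nlinarith [norm_nonneg a, norm_nonneg w]
    refine ⟨g, fun w => g w * ((w - a) / (1 - (starRingEnd ℂ) a * w)),
      fun w => ‖1 - (starRingEnd ℂ) a * w‖, hg,
      hg.mul (DifferentiableOn.div (by fun_prop) (by fun_prop) hne), by fun_prop, ?_, ?_, ?_, ?_⟩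
    · intro w hw
      have := hne w hw
      rw [← mul_assoc, ← sq, hg2, mul_div_cancel₀ _ this]
    · intro w _
      rw [← norm_pow, hg2]
    · intro w hw
      rw [norm_mul, mul_pow, ← norm_pow, hg2]
      refine mul_le_of_le_one_right (norm_nonneg _) ?_
      rw [norm_div]
      refine pow_le_one₀ (by positivity) ?_
      rw [div_le_one (by simpa using hne w hw)]
      exact norm_sub_le_norm_one_sub_conj_mul ha (by simpa using (mem_ball_zero_iff.1 hw).le)
    · intro w hw
      exact (norm_sub_eq_norm_one_sub_conj_mul (by simpa using hw)).symm
  · have ha0 : a ≠ 0 := by rintro rfl; norm_num at ha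
    obtain ⟨g, hg, hg2⟩ := exists_sqrt_one_sub_mul (a := a⁻¹)
      (by rw [norm_inv]; exact inv_le_one_of_one_le₀ ha.le)
    obtain ⟨s, hs⟩ := IsAlgClosed.exists_pow_nat_eq (-a) two_pos
    have key : ∀ w, (s * g w) ^ 2 = w - a := by
      intro w
      rw [mul_pow, hs, hg2]
      field_simp
      ring
    refine ⟨fun w => s * g w, fun w => s * g w, fun w => ‖w - a‖, hg.const_mul s, hg.const_mul s,
      by fun_prop, ?_, ?_, ?_, ?_⟩
    · intro w _
      rw [← sq, key]
    · intro w _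
      rw [← norm_pow, key]
    · intro w _
      rw [← norm_pow, key]
    · intro w _; rfl

theorem hasHardyFactorization_polynomial (p : ℂ[X]) : HasHardyFactorization fun w => p.eval w := by
  have hs := (IsAlgClosed.splits p).eq_prod_roots
  have h : ∀ m : Multiset ℂ, HasHardyFactorization
      fun w => ((m.map fun a => Polynomial.X - Polynomial.C a).prod).eval w := by
    intro m
    induction m using Multiset.induction_on with
    | empty => simpa using hasHardyFactorization_const 1
    | cons a m ih => simpa using (hasHardyFactorization_sub a).mul ih
  rw [hs]
  simpa using (hasHardyFactorization_const p.leadingCoeff).mul (h p.roots)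

/-- The factors need not be polynomials, nor extend to the circle. Hence they are dilated by `r < 1`
and approximated by polynomials `G n`, `H n`, to which the product inequality applies; their squared
means are at most that of `F` up to a vanishing error. -/
theorem sum_sq_norm_coeff_mul_pow_le {p : ℂ[X]} {g h : ℂ → ℂ} {F : ℂ → ℝ}
    (hg : DifferentiableOn ℂ g (ball 0 1)) (hh : DifferentiableOn ℂ h (ball 0 1))
    (hF : Continuous F) (hp : ∀ w ∈ ball (0 : ℂ) 1, p.eval w = g w * h w)
    (hgF : ∀ w ∈ ball (0 : ℂ) 1, ‖g w‖ ^ 2 ≤ F w) (hhF : ∀ w ∈ ball (0 : ℂ) 1, ‖h w‖ ^ 2 ≤ F w)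
    (N : ℕ) {r : ℝ} (hr0 : 0 ≤ r) (hr : r < 1) :
    ∑ k ∈ Finset.range N, ‖(r : ℂ) ^ k * p.coeff k‖ ^ 2 / (k + 1) ≤ circleAverage F 0 r ^ 2 := by
  have hmem : ∀ w : ℂ, ‖w‖ = 1 → (r : ℂ) * w ∈ ball (0 : ℂ) 1 := by
    intro w hw
    simpa [hw, abs_of_nonneg hr0] using hr
  obtain ⟨B, hB0, hB⟩ : ∃ B : ℝ, 0 ≤ B ∧ ∀ w : ℂ, ‖w‖ = 1 → F (r * w) ≤ B ^ 2 := by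
    obtain ⟨B, hB⟩ := (isCompact_sphere (0 : ℂ) 1).bddAbove_image
      (f := fun w => F (r * w)) (by fun_prop)
    refine ⟨max B 1, by positivity, fun w hw => ?_⟩
    have h1 : F (r * w) ≤ B := hB ⟨w, by simpa using hw, rfl⟩
    nlinarith [le_max_left B 1, le_max_right B 1]
  have hgB : ∀ w : ℂ, ‖w‖ = 1 → ‖g (r * w)‖ ≤ B := fun w hw =>
    le_of_sq_le_sq ((hgF _ (hmem w hw)).trans (hB w hw)) hB0
  have hhB : ∀ w : ℂ, ‖w‖ = 1 → ‖h (r * w)‖ ≤ B := fun w hw =>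
    le_of_sq_le_sq ((hhF _ (hmem w hw)).trans (hB w hw)) hB0
  have havg : circleAverage (fun w => F (r * w)) 0 1 = circleAverage F 0 r := by
    rw [circleAverage_eq_circleAverage_zero_one (f := F)]
    simp
  have hsq : ∀ (G : ℂ[X]) (g : ℂ → ℂ) (ε : ℝ), 0 ≤ ε →
      (∀ w ∈ ball (0 : ℂ) 1, ‖g w‖ ^ 2 ≤ F w) → (∀ w : ℂ, ‖w‖ = 1 → ‖g (r * w)‖ ≤ B) →
      (∀ w : ℂ, ‖w‖ = 1 → ‖g (r * w) - G.eval w‖ ≤ ε) →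
      circleAverage (fun w => ‖G.eval w‖ ^ 2) 0 1 ≤ circleAverage F 0 r + (2 * B * ε + ε ^ 2) := by
    intro G g ε hε hgF hgB hG
    rw [← havg, ← circleAverage_const (2 * B * ε + ε ^ 2) 0 1, ← circleAverage_fun_add
      (continuous_circleIntegrable (by fun_prop) _ _)
        (continuous_circleIntegrable (by fun_prop) _ _)]
    refine circleAverage_mono (continuous_circleIntegrable (by fun_prop) _ _)
      (continuous_circleIntegrable (by fun_prop) _ _) fun w hw => ?_
    have hw1 : ‖w‖ = 1 := by simpa using hw
    have h1 := hgF _ (hmem w hw1)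
    have h2 : ‖G.eval w‖ ≤ ‖g (r * w)‖ + ε := by
      have := norm_sub_norm_le (G.eval w) (g (r * w))
      rw [norm_sub_rev] at this
      linarith [hG w hw1]
    nlinarith [norm_nonneg (G.eval w), hgB w hw1, norm_nonneg (g (r * w))]
  let ε : ℕ → ℝ := fun n => 1 / ((n : ℝ) + 1)
  have hε : ∀ n, 0 < ε n := fun n => Nat.one_div_pos_of_nat
  have hε0 : Filter.Tendsto ε Filter.atTop (nhds 0) := tendsto_one_div_add_atTop_nhds_zero_nat
  choose G hG using fun n => exists_polynomial_approx hg hr0 hr (hε n)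
  choose H hH using fun n => exists_polynomial_approx hh hr0 hr (hε n)
  have hcoeff : ∀ k, Filter.Tendsto (fun n => (G n * H n).coeff k) Filter.atTop
      (nhds ((r : ℂ) ^ k * p.coeff k)) := by
    intro k
    rw [tendsto_iff_norm_sub_tendsto_zero]
    refine squeeze_zero (fun _ => norm_nonneg _) (g := fun n => B * ε n + (B + ε n) * ε n) ?_ ?_
    · intro n
      -- By Parseval, a coefficient of `q` is at most the supremum of `|q|` on the circle, where `p
      -- (r w) = g (r w) h (r w)`.
      set q : ℂ[X] := G n * H n - p.comp (Polynomial.C (r : ℂ) * Polynomial.X) with hq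
      have hqk : (G n * H n).coeff k - (r : ℂ) ^ k * p.coeff k = q.coeff k := by
        rw [hq, Polynomial.coeff_sub, Polynomial.comp_C_mul_X_coeff, mul_comm (p.coeff k)]
      rw [hqk]
      have hη : 0 ≤ B * ε n + (B + ε n) * ε n := by have := (hε n).le; positivity
      refine le_of_sq_le_sq ?_ hη
      calc ‖q.coeff k‖ ^ 2 ≤ ∑ i ∈ Finset.range (k + 1), ‖q.coeff i‖ ^ 2 :=
            Finset.single_le_sum (f := fun i => ‖q.coeff i‖ ^ 2) (fun _ _ => by positivity)
              (by simp)
        _ ≤ circleAverage (fun w => ‖q.eval w‖ ^ 2) 0 1 := sum_range_sq_norm_coeff_le q _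
        _ ≤ circleAverage (fun _ => (B * ε n + (B + ε n) * ε n) ^ 2) 0 1 := by
            refine circleAverage_mono (continuous_circleIntegrable (by fun_prop) _ _)
              (continuous_circleIntegrable (by fun_prop) _ _) fun w hw => ?_
            have hw1 : ‖w‖ = 1 := by simpa using hw
            gcongr
            have h1 : q.eval w = ((G n).eval w - g (r * w)) * (H n).eval w +
                g (r * w) * ((H n).eval w - h (r * w)) := by
              simp only [hq, Polynomial.eval_sub, Polynomial.eval_mul, Polynomial.eval_comp,
                Polynomial.eval_C, Polynomial.eval_X, hp _ (hmem w hw1)]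
              ring
            have hG1 := hG n w hw1
            have hH1 := hH n w hw1
            have hH2 : ‖(H n).eval w‖ ≤ B + ε n := by
              have := norm_sub_norm_le ((H n).eval w) (h (r * w))
              rw [norm_sub_rev] at this
              linarith [hhB w hw1]
            rw [norm_sub_rev] at hG1 hH1
            rw [h1]
            refine (norm_add_le _ _).trans ?_
            rw [norm_mul, norm_mul, add_comm]
            refine add_le_add (mul_le_mul (hgB w hw1) hH1 (norm_nonneg _) hB0) ?_
            rw [mul_comm (B + ε n)]
            exact mul_le_mul hG1 hH2 (norm_nonneg _) (hε n).le
        _ = _ := circleAverage_const _ _ _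
    · have : Filter.Tendsto (fun n => B * ε n + (B + ε n) * ε n) Filter.atTop
          (nhds (B * 0 + (B + 0) * 0)) :=
        (hε0.const_mul B).add ((hε0.const_add B).mul hε0)
      simpa using this
  have hlim : Filter.Tendsto (fun n => (circleAverage F 0 r + (2 * B * ε n + ε n ^ 2)) ^ 2)
      Filter.atTop (nhds ((circleAverage F 0 r + (2 * B * 0 + 0 ^ 2)) ^ 2)) :=
    (((hε0.const_mul (2 * B)).add (hε0.pow 2)).const_add _).pow 2
  rw [show circleAverage F 0 r + (2 * B * 0 + 0 ^ 2) = circleAverage F 0 r by ring] at hlim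
  refine le_of_tendsto_of_tendsto' (tendsto_finsetSum _ fun k _ =>
    (((hcoeff k).norm.pow 2).div_const ((k : ℝ) + 1))) hlim fun n => ?_
  refine (sum_sq_norm_coeff_mul_le (G n) (H n) N).trans ?_
  rw [sq]
  have h1 := hsq (G n) g (ε n) (hε n).le hgF hgB (hG n)
  have h2 := hsq (H n) h (ε n) (hε n).le hhF hhB (hH n)
  have h3 : 0 ≤ circleAverage (fun w => ‖(H n).eval w‖ ^ 2) 0 1 :=
    circleAverage_nonneg_of_nonneg fun _ _ => by positivity
  have h4 : 0 ≤ circleAverage (fun w => ‖(G n).eval w‖ ^ 2) 0 1 :=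
    circleAverage_nonneg_of_nonneg fun _ _ => by positivity
  exact mul_le_mul h1 h2 h3 (h4.trans h1)

/-- **Carleman's inequality** for polynomials. -/
theorem carleman (p : ℂ[X]) (N : ℕ) :
    ∑ k ∈ Finset.range N, ‖p.coeff k‖ ^ 2 / (k + 1) ≤
      circleAverage (fun w => ‖p.eval w‖) 0 1 ^ 2 := by
  obtain ⟨g, h, F, hg, hh, hF, h1, h2, h3, h4⟩ := hasHardyFactorization_polynomial p
  have hS : circleAverage (fun w => ‖p.eval w‖) 0 1 = circleAverage F 0 1 :=
    circleAverage_congr_sphere fun w hw => (h4 w (by simpa using hw)).symm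
  rw [hS]
  have hL : Continuous fun r : ℝ =>
      ∑ k ∈ Finset.range N, ‖(r : ℂ) ^ k * p.coeff k‖ ^ 2 / ((k : ℝ) + 1) := by fun_prop
  have hR : Continuous fun r : ℝ => circleAverage F 0 r ^ 2 := (hF.circleAverage).pow 2
  -- Let `r → 1`: `F` is continuous up to the circle, where it equals `|p|`.
  have := le_of_tendsto_of_tendsto
    ((hL.tendsto 1).mono_left nhdsWithin_le_nhds :
      Filter.Tendsto _ (nhdsWithin (1 : ℝ) (Set.Iio 1)) _)
    ((hR.tendsto 1).mono_left nhdsWithin_le_nhds) (by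
      filter_upwards [Ioo_mem_nhdsLT zero_lt_one] with r hr
      exact sum_sq_norm_coeff_mul_pow_le hg hh hF h1 h2 h3 N hr.1.le hr.2)
  simpa using this

end Carleman

/-! ### Normalised measure on the torus and Carleman's inequality in several variables. -/

section Torus

open MeasureTheory

/-- The normalised Lebesgue measure on `[0, 2π]`. -/
def angleMeasure : Measure ℝ := ENNReal.ofReal (2 * π)⁻¹ • volume.restrict (Set.Icc 0 (2 * π))

/-- The normalised Lebesgue measure on the cube `[0, 2π]^n`, which parametrises the `n`-torus. -/
def torusMeasure (n : ℕ) : Measure (Fin n → ℝ) := Measure.pi fun _ => angleMeasure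

/-- The point of the torus of radius `r` with the given angles. -/
def torusPoint {n : ℕ} (r : ℝ) (θ : Fin n → ℝ) : Fin n → ℂ := fun i => circleMap 0 r (θ i)

instance : IsProbabilityMeasure angleMeasure := by
  constructor
  simp only [angleMeasure, Measure.smul_apply, Measure.restrict_apply_univ, Real.volume_Icc,
    smul_eq_mul, sub_zero]
  rw [← ENNReal.ofReal_mul (by positivity), inv_mul_cancel₀ (by positivity), ENNReal.ofReal_one]

instance (n : ℕ) : IsProbabilityMeasure (torusMeasure n) := by
  unfold torusMeasure; infer_instance

@[fun_prop]
theorem continuous_torusPoint {n : ℕ} (r : ℝ) : Continuous (torusPoint r : (Fin n → ℝ) → _) := by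
  unfold torusPoint; fun_prop

theorem norm_torusPoint {n : ℕ} {r : ℝ} (hr : 0 ≤ r) (θ : Fin n → ℝ) (i : Fin n) :
    ‖torusPoint r θ i‖ = r := by
  simp [torusPoint, abs_of_nonneg hr]

theorem torusPoint_cons {n : ℕ} (r : ℝ) (θ : ℝ) (θ' : Fin n → ℝ) :
    torusPoint r (Fin.cons θ θ' : Fin (n + 1) → ℝ) =
      Fin.cons (circleMap 0 r θ) (torusPoint r θ') := by
  ext i
  refine Fin.cases ?_ (fun i => ?_) i <;> simp [torusPoint]

theorem torusMeasure_eq (n : ℕ) : torusMeasure n =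
    ENNReal.ofReal (2 * π)⁻¹ ^ n • volume.restrict (Set.Icc 0 fun _ => 2 * π) := by
  unfold torusMeasure
  refine Measure.pi_eq fun s hs => ?_
  rw [← Set.pi_univ_Icc, volume_pi, Measure.restrict_pi_pi, Measure.smul_apply, Measure.pi_pi]
  simp [angleMeasure, Finset.prod_mul_distrib]

theorem integral_torusMeasure {E : Type*} [NormedAddCommGroup E] [NormedSpace ℝ E] {n : ℕ}
    (F : (Fin n → ℝ) → E) : ∫ θ, F θ ∂torusMeasure n =
      ((2 * π)⁻¹ ^ n) • ∫ θ in Set.Icc 0 fun _ => 2 * π, F θ := by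
  rw [torusMeasure_eq, integral_smul_measure, ENNReal.toReal_pow,
    ENNReal.toReal_ofReal (by positivity)]

theorem integrable_torusMeasure {E : Type*} [NormedAddCommGroup E] {n : ℕ}
    {F : (Fin n → ℝ) → E} (hF : Continuous F) : Integrable F (torusMeasure n) := by
  rw [torusMeasure_eq]
  exact (hF.continuousOn.integrableOn_compact isCompact_Icc).smul_measure (by simp)

theorem integral_angleMeasure {E : Type*} [NormedAddCommGroup E] [NormedSpace ℝ E] (F : ℂ → E)
    (r : ℝ) : ∫ θ, F (circleMap 0 r θ) ∂angleMeasure = circleAverage F 0 r := by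
  rw [angleMeasure, integral_smul_measure, ENNReal.toReal_ofReal (by positivity), circleAverage_def,
    intervalIntegral.integral_of_le (by positivity), integral_Icc_eq_integral_Ioc]

theorem measurePreserving_cons (n : ℕ) :
    MeasurePreserving (fun p : ℝ × (Fin n → ℝ) => (Fin.cons p.1 p.2 : Fin (n + 1) → ℝ))
      (angleMeasure.prod (torusMeasure n)) (torusMeasure (n + 1)) := by
  have := (measurePreserving_piFinSuccAbove (fun _ : Fin (n + 1) => angleMeasure) 0).symm
  convert! this using 2
  simp [MeasurableEquiv.piFinSuccAbove_symm_apply, Fin.insertNthEquiv]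

theorem continuous_cons {n : ℕ} :
    Continuous fun p : ℝ × (Fin n → ℝ) => (Fin.cons p.1 p.2 : Fin (n + 1) → ℝ) := by
  refine continuous_pi fun i => ?_
  refine Fin.cases ?_ (fun i => ?_) i <;> simp <;> fun_prop

theorem integrable_cons {E : Type*} [NormedAddCommGroup E] {n : ℕ}
    {F : (Fin (n + 1) → ℝ) → E} (hF : Continuous F) :
    Integrable (fun p : ℝ × (Fin n → ℝ) => F (Fin.cons p.1 p.2))
      (angleMeasure.prod (torusMeasure n)) :=
  (measurePreserving_cons n).integrable_comp_of_integrable (integrable_torusMeasure hF)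

theorem integral_torusMeasure_prod {E : Type*} [NormedAddCommGroup E] [NormedSpace ℝ E] {n : ℕ}
    {F : (Fin (n + 1) → ℝ) → E} (hF : Continuous F) :
    ∫ θ, F θ ∂torusMeasure (n + 1) =
      ∫ p, F (Fin.cons p.1 p.2) ∂angleMeasure.prod (torusMeasure n) := by
  rw [← (measurePreserving_cons n).map_eq, integral_map]
  · exact continuous_cons.aemeasurable
  · exact hF.aestronglyMeasurable

theorem integral_torusMeasure_succ {E : Type*} [NormedAddCommGroup E] [NormedSpace ℝ E] {n : ℕ}
    {F : (Fin (n + 1) → ℝ) → E} (hF : Continuous F) :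
    ∫ θ, F θ ∂torusMeasure (n + 1) =
      ∫ θ, ∫ θ', F (Fin.cons θ θ') ∂torusMeasure n ∂angleMeasure := by
  rw [integral_torusMeasure_prod hF, integral_prod _ (integrable_cons hF)]

theorem integral_torusMeasure_succ_symm {E : Type*} [NormedAddCommGroup E] [NormedSpace ℝ E]
    {n : ℕ} {F : (Fin (n + 1) → ℝ) → E} (hF : Continuous F) :
    ∫ θ, F θ ∂torusMeasure (n + 1) =
      ∫ θ', ∫ θ, F (Fin.cons θ θ') ∂angleMeasure ∂torusMeasure n := by
  rw [integral_torusMeasure_prod hF, integral_prod_symm _ (integrable_cons hF)]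

/-- **Minkowski's integral inequality** for finite weighted `ℓ²` sums. -/
theorem sqrt_sum_sq_integral_le {X ι : Type*} [Fintype ι] [MeasurableSpace X] {μ : Measure X}
    {f : ι → X → ℝ} (hf : ∀ k, Integrable (f k) μ) {ω : ι → ℝ} (hω : ∀ k, 0 ≤ ω k) :
    √(∑ k, ω k * (∫ x, f k x ∂μ) ^ 2) ≤ ∫ x, √(∑ k, ω k * f k x ^ 2) ∂μ := by
  -- The roots of the weights turn the claim into `‖∫ V‖ ≤ ∫ ‖V‖` in a Euclidean space.
  let V : X → EuclideanSpace ℝ ι := fun x => WithLp.toLp 2 fun k => √(ω k) * f k x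
  have hV : Integrable V μ := by
    have h1 : Integrable (fun x k => √(ω k) * f k x) μ :=
      Integrable.of_eval fun k => (hf k).const_mul _
    exact (PiLp.continuousLinearEquiv 2 ℝ fun _ : ι => ℝ).symm.toContinuousLinearMap.integrable_comp
      h1
  have h1 : ∀ x, ‖V x‖ = √(∑ k, ω k * f k x ^ 2) := by
    intro x
    rw [EuclideanSpace.norm_eq]
    congr 1
    refine Finset.sum_congr rfl fun k _ => ?_
    simp [V, mul_pow, Real.sq_sqrt (hω k)]
  have h2 : ‖∫ x, V x ∂μ‖ = √(∑ k, ω k * (∫ x, f k x ∂μ) ^ 2) := by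
    rw [EuclideanSpace.norm_eq]
    congr 1
    refine Finset.sum_congr rfl fun k _ => ?_
    have : (∫ x, V x ∂μ) k = √(ω k) * ∫ x, f k x ∂μ := by
      rw [← integral_const_mul]
      exact ((EuclideanSpace.proj (𝕜 := ℝ) k).integral_comp_comm hV).symm
    rw [this]
    simp [mul_pow, Real.sq_sqrt (hω k)]
  rw [← h2]
  simp only [← h1]
  exact norm_integral_le_integral_norm V

theorem sum_cons {M : Type*} [AddCommMonoid M] {n N : ℕ} (F : (Fin (n + 1) → Fin N) → M) :
    ∑ α, F α = ∑ k : Fin N, ∑ β : Fin n → Fin N, F (Fin.cons k β) := by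
  rw [← Fintype.sum_prod_type', ← (Fin.consEquiv fun _ => Fin N).sum_comp]
  rfl

theorem carleman_circleMap {N : ℕ} (c : Fin N → ℂ) :
    √(∑ k : Fin N, ((k : ℝ) + 1)⁻¹ * ‖c k‖ ^ 2) ≤
      ∫ θ, ‖∑ k, c k * circleMap 0 1 θ ^ (k : ℕ)‖ ∂angleMeasure := by
  let p : Polynomial ℂ := ∑ k : Fin N, Polynomial.C (c k) * Polynomial.X ^ (k : ℕ)
  have hp : ∀ w, p.eval w = ∑ k, c k * w ^ (k : ℕ) := fun w => by
    simp [p, Polynomial.eval_finsetSum]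
  have hc : ∀ k : Fin N, p.coeff k = c k := by
    intro k
    simp only [p, Polynomial.finsetSum_coeff, Polynomial.coeff_C_mul_X_pow]
    simp [Fin.val_inj]
  have h := carleman p N
  rw [← Fin.sum_univ_eq_sum_range (fun k => ‖p.coeff k‖ ^ 2 / ((k : ℝ) + 1))] at h
  have h0 : 0 ≤ circleAverage (fun w => ‖p.eval w‖) 0 1 :=
    circleAverage_nonneg_of_nonneg fun _ _ => by positivity
  rw [← integral_angleMeasure] at h h0
  simp only [hp] at h h0
  refine Real.sqrt_le_iff.2 ⟨h0, le_of_eq_of_le ?_ h⟩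
  refine Finset.sum_congr rfl fun k _ => ?_
  rw [hc, div_eq_inv_mul]

/-- **Carleman's inequality** for polynomials on the torus. -/
theorem carleman_torus {n N : ℕ} (a : (Fin n → Fin N) → ℂ) :
    √(∑ α, (∏ j, ((α j : ℕ) + 1 : ℝ)⁻¹) * ‖a α‖ ^ 2) ≤
      ∫ θ, ‖∑ α, a α * ∏ j, torusPoint 1 θ j ^ (α j : ℕ)‖ ∂torusMeasure n := by
  induction n with
  | zero => simp [Real.sqrt_sq]
  | succ n ih =>
    let f : Fin N → (Fin n → ℝ) → ℂ := fun k θ =>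
      ∑ β : Fin n → Fin N, a (Fin.cons k β) * ∏ j, torusPoint 1 θ j ^ (β j : ℕ)
    have hcont : ∀ {m : ℕ} (j : Fin m), Continuous fun θ : Fin m → ℝ => torusPoint 1 θ j :=
      fun j => (continuous_apply j).comp (continuous_torusPoint 1)
    have hf : ∀ k, Continuous (f k) := fun k =>
      continuous_finsetSum _ fun β _ => continuous_const.mul
        (continuous_finsetProd _ fun j _ => (hcont j).pow _)
    -- Induction in the last `n` variables for each power of the first; Minkowski moves the integral
    -- outside the `ℓ²` norm; the one-variable inequality then handles the first variable.
    calc √(∑ α, (∏ j, ((α j : ℕ) + 1 : ℝ)⁻¹) * ‖a α‖ ^ 2)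
        = √(∑ k : Fin N, ((k : ℝ) + 1)⁻¹ *
            √(∑ β : Fin n → Fin N, (∏ j, ((β j : ℕ) + 1 : ℝ)⁻¹) * ‖a (Fin.cons k β)‖ ^ 2) ^ 2) := by
          rw [sum_cons]
          congr 1
          refine Finset.sum_congr rfl fun k _ => ?_
          rw [Real.sq_sqrt (Finset.sum_nonneg fun _ _ => by positivity), Finset.mul_sum]
          refine Finset.sum_congr rfl fun β _ => ?_
          rw [Fin.prod_univ_succ, Fin.cons_zero, mul_assoc]
          simp only [Fin.cons_succ]
      _ ≤ √(∑ k : Fin N, ((k : ℝ) + 1)⁻¹ * (∫ θ, ‖f k θ‖ ∂torusMeasure n) ^ 2) := by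
          gcongr with k _
          exact ih fun β => a (Fin.cons k β)
      _ ≤ ∫ θ, √(∑ k : Fin N, ((k : ℝ) + 1)⁻¹ * ‖f k θ‖ ^ 2) ∂torusMeasure n :=
          sqrt_sum_sq_integral_le (fun k => integrable_torusMeasure (hf k).norm)
            fun k => by positivity
      _ ≤ ∫ θ, ∫ θ₀, ‖∑ k, f k θ * circleMap 0 1 θ₀ ^ (k : ℕ)‖ ∂angleMeasure ∂torusMeasure n := by
          refine integral_mono (integrable_torusMeasure (by fun_prop)) ?_
            fun θ => carleman_circleMap fun k => f k θ
          have : Continuous fun θ : Fin (n + 1) → ℝ =>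
              ‖∑ k, f k (Fin.tail θ) * circleMap 0 1 (θ 0) ^ (k : ℕ)‖ := by
            have : Continuous fun θ : Fin (n + 1) → ℝ => (Fin.tail θ : Fin n → ℝ) :=
              continuous_pi fun i => continuous_apply i.succ
            fun_prop
          simpa using (integrable_cons this).integral_prod_right
      _ = _ := by
          have : Continuous fun θ : Fin (n + 1) → ℝ =>
              ‖∑ α, a α * ∏ j, torusPoint 1 θ j ^ (α j : ℕ)‖ :=
            (continuous_finsetSum _ fun β _ => continuous_const.mul
              (continuous_finsetProd _ fun j _ => (hcont j).pow _)).norm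
          rw [integral_torusMeasure_succ_symm this]
          refine integral_congr_ae (.of_forall fun θ => ?_)
          refine integral_congr_ae (.of_forall fun θ₀ => ?_)
          simp only [f, torusPoint_cons]
          rw [sum_cons]
          congr 1
          refine Finset.sum_congr rfl fun k _ => ?_
          rw [Finset.sum_mul]
          refine Finset.sum_congr rfl fun β _ => ?_
          rw [Fin.prod_univ_succ]
          simp only [Fin.cons_zero, Fin.cons_succ]
          ring

end Torus

/-! ### Absolute sums of a bounded polynomial, uniformly in the number of variables. -/

section PolynomialBound

open MeasureTheory

theorem hasDerivAt_prod_pow {n : ℕ} (b u : Fin n → ℂ) (m : Fin n → ℕ) :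
    HasDerivAt (fun l : ℂ => ∏ j, (b j * (1 + l * u j)) ^ m j)
      (∑ k, (m k : ℂ) * u k * ∏ j, b j ^ m j) 0 := by
  have h1 : ∀ j ∈ (Finset.univ : Finset (Fin n)),
      HasDerivAt (fun l : ℂ => (b j * (1 + l * u j)) ^ m j)
        ((m j : ℂ) * b j ^ (m j - 1) * (b j * u j)) 0 := by
    intro j _
    have h2 : HasDerivAt (fun l : ℂ => b j * (1 + l * u j)) (b j * u j) 0 := by
      simpa using (((hasDerivAt_id (0 : ℂ)).mul_const (u j)).const_add 1).const_mul (b j)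
    simpa using h2.fun_pow (m j)
  convert! HasDerivAt.fun_finsetProd h1 using 1
  refine Finset.sum_congr rfl fun k _ => ?_
  rw [← Finset.mul_prod_erase _ _ (Finset.mem_univ k)]
  simp only [zero_mul, add_zero, mul_one, smul_eq_mul]
  rcases Nat.eq_zero_or_pos (m k) with h | h
  · simp [h]
  · obtain ⟨l, hl⟩ := Nat.exists_eq_add_of_lt h
    rw [hl, zero_add, Nat.add_sub_cancel, pow_succ]
    ring

/-- Bound for the Euler derivatives of a polynomial that is bounded on the closed polydisk. -/
theorem sum_norm_euler_le {n N : ℕ} (a : (Fin n → Fin N) → ℂ) {C t : ℝ} (ht0 : 0 < t) (ht1 : t < 1)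
    (hP : ∀ w : Fin n → ℂ, (∀ i, ‖w i‖ ≤ 1) → ‖∑ α, a α * ∏ j, w j ^ (α j : ℕ)‖ ≤ C)
    {w : Fin n → ℂ} (hw : ∀ i, ‖w i‖ ≤ 1) :
    ∑ k, ‖∑ α, ((α k : ℕ) : ℂ) * a α * ∏ j, (t * w j) ^ (α j : ℕ)‖ ≤ C * t / (1 - t) := by
  set E : Fin n → ℂ := fun k => ∑ α, ((α k : ℕ) : ℂ) * a α * ∏ j, (t * w j) ^ (α j : ℕ) with hE
  -- These phases make the sum of the moduli a single directional derivative, namely that of `φ` at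
  -- `0`.
  have hu : ∀ k, ∃ u : ℂ, ‖u‖ ≤ 1 ∧ u * E k = ‖E k‖ := by
    intro k
    rcases eq_or_ne (E k) 0 with h | h
    · exact ⟨0, by simp, by simp [h]⟩
    · refine ⟨(starRingEnd ℂ) (E k) / ‖E k‖, ?_, ?_⟩
      · rw [norm_div, RCLike.norm_conj]
        simp [h]
      · have : (‖E k‖ : ℂ) ≠ 0 := by simpa using h
        rw [div_mul_eq_mul_div, mul_comm, Complex.mul_conj, Complex.normSq_eq_norm_sq, sq,
          Complex.ofReal_mul, mul_div_cancel_right₀ _ this]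
  choose u hu1 hu2 using hu
  let φ : ℂ → ℂ := fun l => ∑ α, a α * ∏ j, (t * w j * (1 + l * u j)) ^ (α j : ℕ)
  have hφ : HasDerivAt φ (∑ k, u k * E k) 0 := by
    have h := HasDerivAt.fun_sum (u := Finset.univ) fun (α : Fin n → Fin N) _ =>
      (hasDerivAt_prod_pow (fun j => t * w j) u fun j => (α j : ℕ)).const_mul (a α)
    convert! h using 1
    simp only [hE, Finset.mul_sum]
    rw [Finset.sum_comm]
    refine Finset.sum_congr rfl fun α _ => Finset.sum_congr rfl fun k _ => ?_
    ring
  -- The radius `R` of the Cauchy estimate solves `t (1 + R) = 1`, the largest one keeping the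
  -- arguments in the closed polydisk.
  have hR : 0 < (1 - t) / t := by
    have : 0 < 1 - t := by linarith
    positivity
  have hφd : Differentiable ℂ φ := by fun_prop
  have hb := Complex.norm_deriv_le_of_forall_mem_sphere_norm_le (c := 0) (f := φ) (C := C) hR
    hφd.diffContOnCl fun l hl => hP _ fun i => by
      have hl' : ‖l‖ = (1 - t) / t := by simpa using hl
      rw [norm_mul, norm_mul, Complex.norm_real, Real.norm_of_nonneg ht0.le]
      have h1 : ‖1 + l * u i‖ ≤ 1 + (1 - t) / t := by
        refine (norm_add_le _ _).trans ?_
        rw [norm_one, norm_mul, hl']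
        have := mul_le_of_le_one_right hR.le (hu1 i)
        linarith
      calc t * ‖w i‖ * ‖1 + l * u i‖ ≤ t * 1 * (1 + (1 - t) / t) := by
            gcongr
            exact hw i
        _ = 1 := by field_simp; ring
  rw [hφ.deriv] at hb
  simp only [hu2] at hb
  rw [← Complex.ofReal_sum, Complex.norm_real, div_div_eq_mul_div] at hb
  exact (le_abs_self _).trans hb

theorem sum_range_succ_mul_pow_le {y : ℝ} (hy0 : 0 ≤ y) (hy1 : y < 1) (N : ℕ) :
    ∑ m : Fin N, ((m : ℕ) + 1 : ℝ) * y ^ (m : ℕ) ≤ ((1 - y)⁻¹) ^ 2 := by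
  have hn : ‖y‖ < 1 := by rwa [Real.norm_of_nonneg hy0]
  have h := (hasSum_coe_mul_geometric_of_norm_lt_one hn).add (hasSum_geometric_of_norm_lt_one hn)
  have h1 : ∀ m : ℕ, (m : ℝ) * y ^ m + y ^ m = (m + 1) * y ^ m := fun m => by ring
  have h2 : y / (1 - y) ^ 2 + (1 - y)⁻¹ = ((1 - y)⁻¹) ^ 2 := by
    have : 1 - y ≠ 0 := by linarith
    field_simp
    ring
  rw [h2] at h
  simp only [h1] at h
  rw [Fin.sum_univ_eq_sum_range fun m => ((m : ℝ) + 1) * y ^ m]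
  exact sum_le_hasSum _ (fun _ _ => by positivity) h

theorem sum_range_mul_pow_le {y : ℝ} (hy0 : 0 ≤ y) (hy1 : y < 1) (N : ℕ) :
    ∑ m : Fin N, ((m : ℕ) : ℝ) * y ^ (m : ℕ) ≤ ((1 - y)⁻¹) ^ 2 * y := by
  have hn : ‖y‖ < 1 := by rwa [Real.norm_of_nonneg hy0]
  have h := hasSum_coe_mul_geometric_of_norm_lt_one hn
  rw [show y / (1 - y) ^ 2 = ((1 - y)⁻¹) ^ 2 * y by rw [inv_pow, div_eq_inv_mul]] at h
  rw [Fin.sum_univ_eq_sum_range fun m => (m : ℝ) * y ^ m]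
  exact sum_le_hasSum _ (fun _ _ => by positivity) h

/-- Dominate by a product over coordinates and exchange product and sum. Exponents outside `R`
vanish; at `k`, `(m + 1) / m² ≤ 2 m` for `m ≥ 1`, and the missing term `m = 0` yields the extra
factor `y k`. -/
theorem sum_filter_prod_le {n N : ℕ} {y : Fin n → ℝ} (hy0 : ∀ j, 0 ≤ y j) (hy1 : ∀ j, y j < 1)
    (k : Fin n) (R : Finset (Fin n)) (hk : k ∈ R) :
    ∑ α : Fin n → Fin N with (α k : ℕ) ≠ 0 ∧ ∀ j, (α j : ℕ) ≠ 0 → j ∈ R,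
      (∏ j, (((α j : ℕ) + 1 : ℝ) * y j ^ (α j : ℕ))) / ((α k : ℕ) : ℝ) ^ 2 ≤
        2 * y k * (∏ j ∈ R, (1 - y j)⁻¹) ^ 2 := by
  classical
  let φ : Fin n → Fin N → ℝ := fun j m =>
    if j = k then 2 * (((m : ℕ) : ℝ) * y k ^ (m : ℕ))
    else if j ∈ R then ((m : ℕ) + 1 : ℝ) * y j ^ (m : ℕ) else if (m : ℕ) = 0 then 1 else 0
  have hφ0 : ∀ j m, 0 ≤ φ j m := by
    intro j m
    have := hy0 j
    have := hy0 k
    simp only [φ]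
    split_ifs <;> positivity
  have hφ : ∀ j, ∑ m, φ j m ≤
      (if j ∈ R then ((1 - y j)⁻¹) ^ 2 else 1) * if j = k then 2 * y k else 1 := by
    intro j
    by_cases hj : j = k
    · subst hj
      simp only [φ, if_true, if_pos hk]
      rw [← Finset.mul_sum]
      linarith [sum_range_mul_pow_le (hy0 j) (hy1 j) N]
    · by_cases hjR : j ∈ R
      · simp only [φ, if_neg hj, if_pos hjR, mul_one]
        exact sum_range_succ_mul_pow_le (hy0 j) (hy1 j) N
      · simp only [φ, if_neg hj, if_neg hjR, mul_one]
        rw [Finset.sum_boole]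
        have : (Finset.univ.filter fun m : Fin N => (m : ℕ) = 0).card ≤ 1 := by
          refine Finset.card_le_one.2 fun a ha b hb => ?_
          simp only [Finset.mem_filter] at ha hb
          exact Fin.ext (ha.2.trans hb.2.symm)
        exact_mod_cast this
  calc ∑ α : Fin n → Fin N with (α k : ℕ) ≠ 0 ∧ ∀ j, (α j : ℕ) ≠ 0 → j ∈ R,
      (∏ j, (((α j : ℕ) + 1 : ℝ) * y j ^ (α j : ℕ))) / ((α k : ℕ) : ℝ) ^ 2
      ≤ ∑ α : Fin n → Fin N with (α k : ℕ) ≠ 0 ∧ ∀ j, (α j : ℕ) ≠ 0 → j ∈ R,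
          ∏ j, φ j (α j) := by
        refine Finset.sum_le_sum fun α hα => ?_
        obtain ⟨hαk, hαR⟩ := (Finset.mem_filter.1 hα).2
        rw [← Finset.mul_prod_erase _ _ (Finset.mem_univ k),
          ← Finset.mul_prod_erase _ _ (Finset.mem_univ k), mul_div_right_comm]
        have h1 : ∏ j ∈ Finset.univ.erase k, (((α j : ℕ) + 1 : ℝ) * y j ^ (α j : ℕ)) =
            ∏ j ∈ Finset.univ.erase k, φ j (α j) := by
          refine Finset.prod_congr rfl fun j hj => ?_
          have hjk := Finset.ne_of_mem_erase hj
          by_cases hjR : j ∈ R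
          · simp [φ, hjk, hjR]
          · have : (α j : ℕ) = 0 := by
              by_contra h
              exact hjR (hαR j h)
            simp [φ, hjk, hjR, this]
        rw [h1]
        refine mul_le_mul_of_nonneg_right ?_ (Finset.prod_nonneg fun j _ => hφ0 j _)
        have h2 : (1 : ℝ) ≤ ((α k : ℕ) : ℝ) := by exact_mod_cast Nat.one_le_iff_ne_zero.2 hαk
        have h3 : 0 ≤ y k ^ (α k : ℕ) := pow_nonneg (hy0 k) _
        simp only [φ, if_true]
        rw [div_le_iff₀ (by positivity)]
        have h4 : ((α k : ℕ) : ℝ) + 1 ≤ 2 * ((α k : ℕ) : ℝ) * ((α k : ℕ) : ℝ) ^ 2 := by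
          nlinarith [sq_nonneg (((α k : ℕ) : ℝ) - 1)]
        calc (((α k : ℕ) : ℝ) + 1) * y k ^ (α k : ℕ)
            ≤ (2 * ((α k : ℕ) : ℝ) * ((α k : ℕ) : ℝ) ^ 2) * y k ^ (α k : ℕ) := by gcongr
          _ = _ := by ring
    _ ≤ ∑ α : Fin n → Fin N, ∏ j, φ j (α j) :=
        Finset.sum_le_sum_of_subset_of_nonneg (Finset.filter_subset _ _)
          fun α _ _ => Finset.prod_nonneg fun j _ => hφ0 j _
    _ = ∏ j, ∑ m, φ j m := (Fintype.prod_sum φ).symm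
    _ ≤ ∏ j, ((if j ∈ R then ((1 - y j)⁻¹) ^ 2 else 1) * if j = k then 2 * y k else 1) :=
        Finset.prod_le_prod (fun j _ => Finset.sum_nonneg fun m _ => hφ0 j m) fun j _ => hφ j
    _ = _ := by
        rw [Finset.prod_mul_distrib, Finset.prod_ite_eq', Finset.prod_ite_mem, ← Finset.prod_pow]
        simp [mul_comm]

theorem sum_biUnion_le {ι β : Type*} [DecidableEq β] (s : Finset ι) (G : ι → Finset β) {f : β → ℝ}
    (hf : ∀ b, 0 ≤ f b) : ∑ b ∈ s.biUnion G, f b ≤ ∑ i ∈ s, ∑ b ∈ G i, f b := by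
  classical
  induction s using Finset.induction_on with
  | empty => simp
  | insert i s hi ih =>
    rw [Finset.biUnion_insert, Finset.sum_insert hi]
    refine le_trans ?_ (add_le_add_right ih _)
    rw [← Finset.sum_union_inter]
    exact le_add_of_nonneg_right (Finset.sum_nonneg fun b _ => hf b)

/-- The main estimate for the absolute values of the terms of a polynomial. -/
theorem sum_norm_mul_prod_le {n N : ℕ} (a : (Fin n → Fin N) → ℂ) {C t K : ℝ} (ht0 : 0 < t)
    (ht1 : t < 1) (hC : 0 ≤ C)
    (hP : ∀ w : Fin n → ℂ, (∀ i, ‖w i‖ ≤ 1) → ‖∑ α, a α * ∏ j, w j ^ (α j : ℕ)‖ ≤ C)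
    {x : Fin n → ℝ} (hx0 : ∀ j, 0 ≤ x j) (hxt : ∀ j, x j < t) (hK0 : 0 ≤ K)
    (hK : ∀ k, x k * ∏ j with x k ≤ x j, (1 - (x j / t) ^ 2)⁻¹ ≤ K) :
    ∑ α, ‖a α‖ * ∏ j, x j ^ (α j : ℕ) ≤ C + 2 * K * C / (1 - t) := by
  classical
  -- The weighted `ℓ²` norm of the coefficients of the `k`-th Euler derivative, dilated by `t`.
  -- Carleman bounds it by an `L¹` norm, and the sum over `k` is estimated pointwise under the
  -- integral.
  set A : Fin n → ℝ := fun k => √(∑ α, (∏ j, ((α j : ℕ) + 1 : ℝ)⁻¹) *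
    ‖((α k : ℕ) : ℂ) * a α * ∏ j, (t : ℂ) ^ (α j : ℕ)‖ ^ 2) with hA
  have hAsum : ∑ k, A k ≤ C * t / (1 - t) := by
    have hcont : ∀ k, Continuous fun θ : Fin n → ℝ =>
        ‖∑ α, ((α k : ℕ) : ℂ) * a α * (∏ j, (t : ℂ) ^ (α j : ℕ)) *
          ∏ j, torusPoint 1 θ j ^ (α j : ℕ)‖ := fun k =>
      (continuous_finsetSum _ fun β _ => continuous_const.mul (continuous_finsetProd _
        fun j _ => ((continuous_apply j).comp (continuous_torusPoint 1)).pow _)).norm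
    calc ∑ k, A k ≤ ∑ k, ∫ θ, ‖∑ α, ((α k : ℕ) : ℂ) * a α * (∏ j, (t : ℂ) ^ (α j : ℕ)) *
          ∏ j, torusPoint 1 θ j ^ (α j : ℕ)‖ ∂torusMeasure n :=
          Finset.sum_le_sum fun k _ => carleman_torus _
      _ = ∫ θ, ∑ k, ‖∑ α, ((α k : ℕ) : ℂ) * a α * (∏ j, (t : ℂ) ^ (α j : ℕ)) *
          ∏ j, torusPoint 1 θ j ^ (α j : ℕ)‖ ∂torusMeasure n :=
          (integral_finsetSum _ fun k _ => integrable_torusMeasure (hcont k)).symm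
      _ ≤ ∫ _, C * t / (1 - t) ∂torusMeasure n := by
          refine integral_mono (integrable_torusMeasure (continuous_finsetSum _ fun k _ => hcont k))
            (integrable_const _) fun θ => ?_
          refine le_of_eq_of_le ?_ (sum_norm_euler_le a ht0 ht1 hP
            (w := torusPoint 1 θ) fun i => (norm_torusPoint zero_le_one θ i).le)
          refine Finset.sum_congr rfl fun k _ => ?_
          congr 1
          refine Finset.sum_congr rfl fun α _ => ?_
          simp only [mul_pow, Finset.prod_mul_distrib]
          ring
      _ = _ := by simp
  -- The multi-indices whose support contains `k` and on whose support `x` is smallest at `k`. Ties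
  -- make these classes overlap, which is harmless for an upper bound.
  let G : Fin n → Finset (Fin n → Fin N) := fun k =>
    Finset.univ.filter fun α => (α k : ℕ) ≠ 0 ∧ ∀ j, (α j : ℕ) ≠ 0 →
      j ∈ Finset.univ.filter fun j => x k ≤ x j
  have hG : ∀ k, ∑ α ∈ G k, ‖a α‖ * ∏ j, x j ^ (α j : ℕ) ≤ A k * (2 * K / t) := by
    intro k
    -- Splitting for Cauchy–Schwarz: the first factor builds `A k`; the second receives the inverse
    -- weights, the dilation by `1 / t` and the division by `α k`.
    have h1 : ∀ α ∈ G k, ‖a α‖ * ∏ j, x j ^ (α j : ℕ) =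
        (√(∏ j, ((α j : ℕ) + 1 : ℝ)⁻¹) * ‖((α k : ℕ) : ℂ) * a α * ∏ j, (t : ℂ) ^ (α j : ℕ)‖) *
        (√(∏ j, ((α j : ℕ) + 1 : ℝ)) * (∏ j, (x j / t) ^ (α j : ℕ)) / ((α k : ℕ) : ℝ)) := by
      intro α hα
      have hαk : ((α k : ℕ) : ℝ) ≠ 0 := by exact_mod_cast (Finset.mem_filter.1 hα).2.1
      have hs : √(∏ j, ((α j : ℕ) + 1 : ℝ)⁻¹) * √(∏ j, ((α j : ℕ) + 1 : ℝ)) = 1 := by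
        rw [← Real.sqrt_mul (by positivity), ← Finset.prod_mul_distrib]
        rw [Finset.prod_eq_one fun j _ => inv_mul_cancel₀ (by positivity), Real.sqrt_one]
      have ht : ‖∏ j, (t : ℂ) ^ (α j : ℕ)‖ * ∏ j, (x j / t) ^ (α j : ℕ) =
          ∏ j, x j ^ (α j : ℕ) := by
        rw [norm_prod, ← Finset.prod_mul_distrib]
        refine Finset.prod_congr rfl fun j _ => ?_
        rw [norm_pow, Complex.norm_real, Real.norm_of_nonneg ht0.le, ← mul_pow,
          mul_div_cancel₀ _ ht0.ne']
      rw [norm_mul, norm_mul, Complex.norm_natCast]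
      calc ‖a α‖ * ∏ j, x j ^ (α j : ℕ)
          = (√(∏ j, ((α j : ℕ) + 1 : ℝ)⁻¹) * √(∏ j, ((α j : ℕ) + 1 : ℝ))) *
            (((α k : ℕ) : ℝ) / ((α k : ℕ) : ℝ)) * ‖a α‖ *
            (‖∏ j, (t : ℂ) ^ (α j : ℕ)‖ * ∏ j, (x j / t) ^ (α j : ℕ)) := by
            rw [hs, ht, div_self hαk]; ring
        _ = _ := by ring
    rw [Finset.sum_congr rfl h1]
    refine (Real.sum_mul_le_sqrt_mul_sqrt _ _ _).trans ?_
    refine mul_le_mul ?_ ?_ (Real.sqrt_nonneg _) (Real.sqrt_nonneg _)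
    · refine Real.sqrt_le_sqrt ?_
      refine (Finset.sum_le_sum_of_subset_of_nonneg (Finset.subset_univ _)
        fun _ _ _ => by positivity).trans (le_of_eq ?_)
      refine Finset.sum_congr rfl fun α _ => ?_
      rw [mul_pow, Real.sq_sqrt (Finset.prod_nonneg fun _ _ => by positivity)]
    · have hy1 : ∀ j, (x j / t) ^ 2 < 1 := fun j => by
        have h0 : 0 ≤ x j / t := div_nonneg (hx0 j) ht0.le
        have h1 : x j / t < 1 := (div_lt_one ht0).2 (hxt j)
        exact pow_lt_one₀ h0 h1 two_ne_zero
      have h2 := sum_filter_prod_le (N := N) (y := fun j => (x j / t) ^ 2) (fun j => by positivity)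
        hy1 k (Finset.univ.filter fun j => x k ≤ x j) (by simp)
      refine Real.sqrt_le_iff.2 ⟨by positivity, ?_⟩
      calc _ = _ := by
            refine Finset.sum_congr rfl fun α _ => ?_
            rw [div_pow, mul_pow, Real.sq_sqrt (Finset.prod_nonneg fun _ _ => by positivity),
              ← Finset.prod_pow, ← Finset.prod_mul_distrib]
            congr 1
            refine Finset.prod_congr rfl fun j _ => ?_
            rw [pow_right_comm]
        _ ≤ _ := h2
        _ = 2 * ((x k * ∏ j with x k ≤ x j, (1 - (x j / t) ^ 2)⁻¹) / t) ^ 2 := by ring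
        _ ≤ 2 * (K / t) ^ 2 := by
            have : 0 ≤ x k * ∏ j with x k ≤ x j, (1 - (x j / t) ^ 2)⁻¹ :=
              mul_nonneg (hx0 k) (Finset.prod_nonneg fun j _ =>
                inv_nonneg.2 (sub_nonneg.2 (hy1 j).le))
            gcongr
            exact hK k
        _ ≤ (2 * K / t) ^ 2 := by
            have : 0 ≤ (K / t) ^ 2 := by positivity
            calc 2 * (K / t) ^ 2 ≤ 4 * (K / t) ^ 2 := by linarith
              _ = _ := by ring
  let Z : Finset (Fin n → Fin N) := Finset.univ.filter fun α => ∀ j, (α j : ℕ) = 0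
  have hZ : ∑ α ∈ Z, ‖a α‖ * ∏ j, x j ^ (α j : ℕ) ≤ C := by
    have hcard : Z.card ≤ 1 := Finset.card_le_one.2 fun α hα β hβ => by
      funext j
      exact Fin.ext (((Finset.mem_filter.1 hα).2 j).trans ((Finset.mem_filter.1 hβ).2 j).symm)
    have hle : ∀ α ∈ Z, ‖a α‖ * ∏ j, x j ^ (α j : ℕ) ≤ C := by
      intro α hα
      have hα0 := (Finset.mem_filter.1 hα).2
      have := hP (fun _ => 0) (by simp)
      rw [Finset.sum_eq_single α] at this
      · simpa [hα0] using this
      · intro β _ hβ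
        obtain ⟨j, hj⟩ : ∃ j, (β j : ℕ) ≠ 0 := by
          by_contra! h
          exact hβ (funext fun j => Fin.ext ((h j).trans (hα0 j).symm))
        rw [Finset.prod_eq_zero (Finset.mem_univ j) (zero_pow hj), mul_zero]
      · simp
    refine (Finset.sum_le_card_nsmul _ _ _ hle).trans ?_
    rw [nsmul_eq_mul]
    exact mul_le_of_le_one_left hC (by exact_mod_cast hcard)
  have hnn : ∀ α : Fin n → Fin N, 0 ≤ ‖a α‖ * ∏ j, x j ^ (α j : ℕ) := fun α =>
    mul_nonneg (norm_nonneg _) (Finset.prod_nonneg fun j _ => pow_nonneg (hx0 j) _)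
  have hcover : (Finset.univ : Finset (Fin n → Fin N)) ⊆ Z ∪ Finset.univ.biUnion G := by
    intro α _
    rw [Finset.mem_union]
    by_cases h : ∀ j, (α j : ℕ) = 0
    · left
      exact Finset.mem_filter.2 ⟨Finset.mem_univ _, h⟩
    · right
      push Not at h
      obtain ⟨j₀, hj₀⟩ := h
      obtain ⟨k, hk, hmin⟩ := Finset.exists_min_image
        (Finset.univ.filter fun j => (α j : ℕ) ≠ 0) x ⟨j₀, by simpa using hj₀⟩
      rw [Finset.mem_biUnion]
      refine ⟨k, Finset.mem_univ _, Finset.mem_filter.2 ⟨Finset.mem_univ _, by simpa using hk, ?_⟩⟩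
      intro j hj
      simpa using hmin j (by simpa using hj)
  calc ∑ α, ‖a α‖ * ∏ j, x j ^ (α j : ℕ)
      ≤ ∑ α ∈ Z ∪ Finset.univ.biUnion G, ‖a α‖ * ∏ j, x j ^ (α j : ℕ) :=
        Finset.sum_le_sum_of_subset_of_nonneg hcover fun α _ _ => hnn α
    _ ≤ ∑ α ∈ Z, ‖a α‖ * ∏ j, x j ^ (α j : ℕ) +
        ∑ α ∈ Finset.univ.biUnion G, ‖a α‖ * ∏ j, x j ^ (α j : ℕ) := by
        rw [← Finset.sum_union_inter]
        exact le_add_of_nonneg_right (Finset.sum_nonneg fun α _ => hnn α)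
    _ ≤ C + ∑ k, ∑ α ∈ G k, ‖a α‖ * ∏ j, x j ^ (α j : ℕ) := by
        refine add_le_add hZ ?_
        exact sum_biUnion_le _ _ hnn
    _ ≤ C + ∑ k, A k * (2 * K / t) := by gcongr with k _; exact hG k
    _ ≤ C + C * t / (1 - t) * (2 * K / t) := by
        rw [← Finset.sum_mul]
        gcongr
    _ = _ := by
        have : 1 - t ≠ 0 := by linarith
        field_simp

end PolynomialBound

/-! ### Cauchy's formula and power series on finite-dimensional polydisks. -/

section Cauchy

open MeasureTheory

/-- The coefficient of index `β` in the Fourier expansion of `g` on the torus of radius `r`. -/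
def torusCoeff (n : ℕ) (r : ℝ) (g : (Fin n → ℂ) → ℂ) (β : Fin n → ℕ) : ℂ :=
  ∫ θ, g (torusPoint r θ) * (∏ i, torusPoint r θ i ^ β i)⁻¹ ∂torusMeasure n

theorem circleAverage_pow_mul_inv_pow {r : ℝ} (hr : 0 < r) (a b : ℕ) :
    circleAverage (fun z : ℂ => z ^ a * (z ^ b)⁻¹) 0 r = if a = b then 1 else 0 := by
  have h1 : circleAverage (fun z : ℂ => z ^ a * (z ^ b)⁻¹) 0 r =
      circleAverage (fun z : ℂ => z ^ ((a : ℤ) - b)) 0 r := by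
    refine circleAverage_congr_sphere fun z hz => ?_
    have hz0 : z ≠ 0 := by
      rintro rfl
      simp [abs_of_pos hr] at hz
      exact hr.ne hz
    simp only [zpow_sub₀ hz0, zpow_natCast, div_eq_mul_inv]
  rw [h1]
  split_ifs with h
  · subst h
    simp [circleAverage_const]
  · rw [circleAverage_eq_circleIntegral hr.ne']
    have h2 : (∮ z in C(0, r), (z - 0)⁻¹ • z ^ ((a : ℤ) - b)) =
        ∮ z in C(0, r), (z - 0) ^ ((a : ℤ) - b - 1) := by
      refine circleIntegral.integral_congr hr.le fun z hz => ?_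
      have hz0 : z ≠ 0 := by
        rintro rfl
        simp at hz
        exact hr.ne hz
      simp only [sub_zero, smul_eq_mul]
      rw [zpow_sub_one₀ hz0, mul_comm]
    rw [h2, circleIntegral.integral_sub_zpow_of_ne (by omega), smul_zero]

theorem integral_prod_pow_mul_inv {n : ℕ} {r : ℝ} (hr : 0 < r) (α β : Fin n → ℕ) :
    ∫ θ, (∏ i, torusPoint r θ i ^ α i) * (∏ i, torusPoint r θ i ^ β i)⁻¹ ∂torusMeasure n =
      if α = β then 1 else 0 := by
  have h1 : ∀ θ : Fin n → ℝ, (∏ i, torusPoint r θ i ^ α i) * (∏ i, torusPoint r θ i ^ β i)⁻¹ =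
      ∏ i, (circleMap 0 r (θ i) ^ α i * (circleMap 0 r (θ i) ^ β i)⁻¹) := by
    intro θ
    simp only [torusPoint]
    rw [Finset.prod_mul_distrib, Finset.prod_inv_distrib]
  simp only [h1]
  unfold torusMeasure
  rw [integral_fintype_prod_eq_prod
    (fun i (θ : ℝ) => circleMap 0 r θ ^ α i * (circleMap 0 r θ ^ β i)⁻¹)]
  have h2 : ∀ i, ∫ θ, circleMap 0 r θ ^ α i * (circleMap 0 r θ ^ β i)⁻¹ ∂angleMeasure =
      if α i = β i then 1 else 0 := fun i => by
    rw [← circleAverage_pow_mul_inv_pow hr, ← integral_angleMeasure]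
  simp only [h2]
  split_ifs with h
  · simp [h]
  · obtain ⟨i, hi⟩ := Function.ne_iff.1 h
    exact Finset.prod_eq_zero (Finset.mem_univ i) (if_neg hi)

theorem continuous_torusPoint_apply {n : ℕ} (r : ℝ) (i : Fin n) :
    Continuous fun θ : Fin n → ℝ => torusPoint r θ i :=
  (continuous_apply i).comp (continuous_torusPoint r)

theorem torusPoint_ne_zero {n : ℕ} {r : ℝ} (hr : 0 < r) (θ : Fin n → ℝ) (i : Fin n) :
    torusPoint r θ i ≠ 0 := by
  rw [← norm_ne_zero_iff, norm_torusPoint hr.le]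
  exact hr.ne'

theorem continuous_prod_torusPoint_inv {n : ℕ} {r : ℝ} (hr : 0 < r) (β : Fin n → ℕ) :
    Continuous fun θ : Fin n → ℝ => (∏ i, torusPoint r θ i ^ β i)⁻¹ :=
  Continuous.inv₀ (continuous_finsetProd _ fun i _ => (continuous_torusPoint_apply r i).pow _)
    fun θ => Finset.prod_ne_zero_iff.2 fun i _ => pow_ne_zero _ (torusPoint_ne_zero hr θ i)

theorem norm_prod_torusPoint {n : ℕ} {r : ℝ} (hr : 0 ≤ r) (β : Fin n → ℕ) (θ : Fin n → ℝ) :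
    ‖∏ i, torusPoint r θ i ^ β i‖ = ∏ i, r ^ β i := by
  simp only [norm_prod, norm_pow, norm_torusPoint hr]

/-- The Fourier coefficients on a torus of an absolutely convergent power series. -/
theorem torusCoeff_eq_of_hasSum {n : ℕ} {r : ℝ} (hr : 0 < r) {g : (Fin n → ℂ) → ℂ}
    {a : (Fin n → ℕ) → ℂ} (ha : Summable fun α => ‖a α‖ * ∏ i, r ^ α i)
    (hg : ∀ w : Fin n → ℂ, (∀ i, ‖w i‖ = r) → HasSum (fun α => a α * ∏ i, w i ^ α i) (g w))
    (β : Fin n → ℕ) : torusCoeff n r g β = a β := by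
  let F : (Fin n → ℕ) → (Fin n → ℝ) → ℂ := fun α θ =>
    a α * ((∏ i, torusPoint r θ i ^ α i) * (∏ i, torusPoint r θ i ^ β i)⁻¹)
  have hF : ∀ α, Continuous (F α) := fun α => continuous_const.mul
    ((continuous_finsetProd _ fun i _ => (continuous_torusPoint_apply r i).pow _).mul
      (continuous_prod_torusPoint_inv hr β))
  have hnorm : ∀ α θ, ‖F α θ‖ = ‖a α‖ * (∏ i, r ^ α i) * (∏ i, r ^ β i)⁻¹ := by
    intro α θ
    simp only [F, norm_mul, norm_inv, norm_prod_torusPoint hr.le, mul_assoc]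
  have h := hasSum_integral_of_summable_integral_norm (μ := torusMeasure n)
    (fun α => integrable_torusMeasure (hF α)) (by
      simp only [hnorm, integral_const, probReal_univ, one_smul]
      exact ha.mul_right _)
  have h1 : ∀ θ, ∑' α, F α θ = g (torusPoint r θ) * (∏ i, torusPoint r θ i ^ β i)⁻¹ := by
    intro θ
    have := (hg (torusPoint r θ) fun i => norm_torusPoint hr.le θ i).mul_right
      (∏ i, torusPoint r θ i ^ β i)⁻¹
    simp only [mul_assoc] at this
    exact this.tsum_eq
  have h2 : ∀ α, ∫ θ, F α θ ∂torusMeasure n = if α = β then a β else 0 := by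
    intro α
    simp only [F]
    rw [integral_const_mul, integral_prod_pow_mul_inv hr]
    split_ifs with h <;> simp [h]
  simp only [h1, h2] at h
  exact h.unique (hasSum_ite_eq β (a β))

theorem hasSum_prod_pow {𝕜 : Type*} [RCLike 𝕜] {n : ℕ} {x : Fin n → 𝕜}
    (hx : ∀ i, ‖x i‖ < 1) :
    Summable (fun α : Fin n → ℕ => ‖∏ i, x i ^ α i‖) ∧
      HasSum (fun α : Fin n → ℕ => ∏ i, x i ^ α i) (∏ i, (1 - x i)⁻¹) := by
  induction n with
  | zero =>
    have h : HasSum (fun α : Fin 0 → ℕ => ∏ i, x i ^ α i) (∏ i, (1 - x i)⁻¹) := by simp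
    have h' : Summable (fun α : Fin 0 → ℕ => ‖∏ i, x i ^ α i‖) :=
      (hasSum_fintype _).summable
    exact ⟨h', h⟩
  | succ n ih =>
    obtain ⟨h1, h2⟩ := ih (x := fun i => x i.succ) fun i => hx i.succ
    have h0 : HasSum (fun m : ℕ => x 0 ^ m) (1 - x 0)⁻¹ := hasSum_geometric_of_norm_lt_one (hx 0)
    have h0' : Summable fun m : ℕ => ‖x 0 ^ m‖ := by
      simp only [norm_pow]
      exact summable_geometric_of_lt_one (norm_nonneg _) (hx 0)
    have hs := Summable.mul_norm h0' h1
    have hm := HasSum.mul h0 h2 hs.of_norm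
    have he : ∀ p : ℕ × (Fin n → ℕ), ∏ i, x i ^ (Fin.consEquiv fun _ => ℕ) p i =
        x 0 ^ p.1 * ∏ i : Fin n, x i.succ ^ p.2 i := fun p => by
      rw [Fin.prod_univ_succ]
      rfl
    constructor
    · rw [← (Fin.consEquiv fun _ : Fin (n + 1) => ℕ).summable_iff]
      exact hs.congr fun p => by rw [Function.comp_apply, he]
    · rw [← (Fin.consEquiv fun _ : Fin (n + 1) => ℕ).hasSum_iff, Fin.prod_univ_succ]
      exact hm.congr_fun fun p => by rw [Function.comp_apply, he]

theorem norm_torusPoint_le {n : ℕ} {r : ℝ} (hr : 0 ≤ r) (θ : Fin n → ℝ) : ‖torusPoint r θ‖ ≤ r :=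
  (pi_norm_le_iff_of_nonneg hr).2 fun i => (norm_torusPoint hr θ i).le

theorem continuous_comp_torusPoint {n : ℕ} {r : ℝ} (hr0 : 0 < r) (hr : r < 1)
    {g : (Fin n → ℂ) → ℂ} (hg : ContinuousOn g (ball 0 1)) :
    Continuous fun θ : Fin n → ℝ => g (torusPoint r θ) :=
  hg.comp_continuous (continuous_torusPoint r) fun θ => by
    simpa using (norm_torusPoint_le hr0.le θ).trans_lt hr

/-- **Cauchy's integral formula** on a polydisk. -/
theorem integral_cauchy_torus {n : ℕ} {r : ℝ} (hr0 : 0 < r) (hr : r < 1) {g : (Fin n → ℂ) → ℂ}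
    (hg : DifferentiableOn ℂ g (ball 0 1)) {w : Fin n → ℂ} (hw : ∀ i, ‖w i‖ < r) :
    ∫ θ, g (torusPoint r θ) * ∏ i, (torusPoint r θ i / (torusPoint r θ i - w i)) ∂torusMeasure n =
      g w := by
  induction n with
  | zero =>
    have : ∀ θ : Fin 0 → ℝ, torusPoint r θ = w := fun θ => Subsingleton.elim _ _
    simp [this]
  | succ n ih =>
    have hcons : ∀ (u : ℂ) (v : Fin n → ℂ), ‖u‖ < 1 → ‖v‖ < 1 →
        (Fin.cons u v : Fin (n + 1) → ℂ) ∈ ball (0 : Fin (n + 1) → ℂ) 1 := by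
      intro u v hu hv
      rw [mem_ball_zero_iff, pi_norm_lt_iff one_pos] at *
      intro i
      refine Fin.cases ?_ (fun i => ?_) i
      · simpa using hu
      · simpa using hv i
    have hne : ∀ (θ : Fin (n + 1) → ℝ) i, torusPoint r θ i - w i ≠ 0 := fun θ i h => by
      have := norm_torusPoint hr0.le θ i
      rw [sub_eq_zero.1 h] at this
      exact (hw i).ne this
    have hc : Continuous fun θ : Fin (n + 1) → ℝ =>
        g (torusPoint r θ) * ∏ i, (torusPoint r θ i / (torusPoint r θ i - w i)) :=
      (continuous_comp_torusPoint hr0 hr hg.continuousOn).mul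
        (continuous_finsetProd _ fun i _ => (continuous_torusPoint_apply r i).div
          ((continuous_torusPoint_apply r i).sub continuous_const) fun θ => hne θ i)
    rw [integral_torusMeasure_succ hc]
    have hinner : ∀ θ : ℝ, ∫ θ' : Fin n → ℝ, g (torusPoint r (Fin.cons θ θ' : Fin (n + 1) → ℝ)) *
        ∏ i, (torusPoint r (Fin.cons θ θ' : Fin (n + 1) → ℝ) i /
          (torusPoint r (Fin.cons θ θ' : Fin (n + 1) → ℝ) i - w i)) ∂torusMeasure n =
        ((circleMap 0 r θ - 0) / (circleMap 0 r θ - w 0)) •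
          g (Fin.cons (circleMap 0 r θ) (Fin.tail w)) := by
      intro θ
      have hd : DifferentiableOn ℂ (fun v : Fin n → ℂ => g (Fin.cons (circleMap 0 r θ) v))
          (ball 0 1) := by
        refine hg.comp (t := ball 0 1) ?_ fun v hv =>
          hcons _ _ (by simpa [abs_of_pos hr0] using hr) (by simpa using hv)
        refine Differentiable.differentiableOn (differentiable_pi.2 fun i => ?_)
        refine Fin.cases ?_ (fun i => ?_) i
        · simp
        · simp only [Fin.cons_succ]
          fun_prop
      rw [← ih hd (w := Fin.tail w) fun i => hw i.succ, sub_zero, smul_eq_mul,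
        ← integral_const_mul]
      refine integral_congr_ae (.of_forall fun θ' => ?_)
      simp only [torusPoint_cons, Fin.prod_univ_succ, Fin.cons_zero, Fin.cons_succ, Fin.tail]
      ring
    simp only [hinner]
    rw [integral_angleMeasure
      (fun z => ((z - 0) / (z - w 0)) • g (Fin.cons z (Fin.tail w))) r]
    have hd : DifferentiableOn ℂ (fun z : ℂ => g (Fin.cons z (Fin.tail w))) (ball 0 1) := by
      refine hg.comp (t := ball 0 1) ?_ fun v hv => hcons _ _ (by simpa using hv) ?_
      · refine Differentiable.differentiableOn (differentiable_pi.2 fun i => ?_)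
        refine Fin.cases ?_ (fun i => ?_) i <;> simp
      · rw [pi_norm_lt_iff one_pos]
        exact fun i => (hw i.succ).trans hr
    rw [DiffContOnCl.circleAverage_smul_div (f := fun z => g (Fin.cons z (Fin.tail w)))]
    · rw [Fin.cons_self_tail]
    · refine (hd.mono (closedBall_subset_ball ?_)).diffContOnCl_ball subset_rfl
      rwa [abs_of_pos hr0]
    · simpa [abs_of_pos hr0] using hw 0

/-- Power series expansion in a polydisk, with coefficients computed on one torus. -/
theorem hasSum_torusCoeff {n : ℕ} {r : ℝ} (hr0 : 0 < r) (hr : r < 1) {g : (Fin n → ℂ) → ℂ}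
    (hg : DifferentiableOn ℂ g (ball 0 1)) {w : Fin n → ℂ} (hw : ∀ i, ‖w i‖ < r) :
    Summable (fun α => ‖torusCoeff n r g α‖ * ∏ i, ‖w i‖ ^ α i) ∧
      HasSum (fun α => torusCoeff n r g α * ∏ i, w i ^ α i) (g w) := by
  have hgc := continuous_comp_torusPoint hr0 hr hg.continuousOn
  obtain ⟨B, hB⟩ : ∃ B, ∀ θ : Fin n → ℝ, ‖g (torusPoint r θ)‖ ≤ B := by
    obtain ⟨B, hB⟩ := (isCompact_closedBall (0 : Fin n → ℂ) r).exists_bound_of_continuousOn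
      (hg.continuousOn.mono (closedBall_subset_ball hr))
    exact ⟨B, fun θ => hB _ (by simpa using norm_torusPoint_le hr0.le θ)⟩
  let F : (Fin n → ℕ) → (Fin n → ℝ) → ℂ := fun α θ =>
    g (torusPoint r θ) * (∏ i, torusPoint r θ i ^ α i)⁻¹ * ∏ i, w i ^ α i
  have hF : ∀ α, Continuous (F α) := fun α =>
    (hgc.mul (continuous_prod_torusPoint_inv hr0 α)).mul continuous_const
  have hx : ∀ i, ‖‖w i‖ / r‖ < 1 := fun i => by
    rw [Real.norm_of_nonneg (by positivity), div_lt_one hr0]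
    exact hw i
  have hFle : ∀ α θ, ‖F α θ‖ ≤ B * ‖∏ i, (‖w i‖ / r) ^ α i‖ := by
    intro α θ
    rw [Real.norm_of_nonneg (Finset.prod_nonneg fun i _ => by positivity)]
    simp only [F, norm_mul, norm_inv, norm_prod_torusPoint hr0.le, div_pow, Finset.prod_div_distrib,
      norm_prod, norm_pow]
    rw [mul_assoc, ← div_eq_inv_mul]
    have : 0 ≤ (∏ i, ‖w i‖ ^ α i) / ∏ i, r ^ α i := by positivity
    exact mul_le_mul_of_nonneg_right (hB θ) this
  have hsum := (hasSum_prod_pow hx).1.mul_left B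
  have hint : Summable fun α => ∫ θ, ‖F α θ‖ ∂torusMeasure n := by
    refine hsum.of_nonneg_of_le (fun α => integral_nonneg fun θ => norm_nonneg _) fun α => ?_
    calc ∫ θ, ‖F α θ‖ ∂torusMeasure n
        ≤ ∫ _, B * ‖∏ i, (‖w i‖ / r) ^ α i‖ ∂torusMeasure n :=
          integral_mono (integrable_torusMeasure (hF α).norm) (integrable_const _) (hFle α)
      _ = _ := by simp
  have hcoeff : ∀ α, ∫ θ, F α θ ∂torusMeasure n = torusCoeff n r g α * ∏ i, w i ^ α i := fun α => by
    simp only [F]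
    rw [integral_mul_const, torusCoeff]
  constructor
  · refine hint.of_nonneg_of_le (fun α => by positivity) fun α => ?_
    rw [show ‖torusCoeff n r g α‖ * ∏ i, ‖w i‖ ^ α i = ‖∫ θ, F α θ ∂torusMeasure n‖ by
      rw [hcoeff, norm_mul, norm_prod]; simp only [norm_pow]]
    exact norm_integral_le_integral_norm _
  · have h := hasSum_integral_of_summable_integral_norm (μ := torusMeasure n)
      (fun α => integrable_torusMeasure (hF α)) hint
    simp only [hcoeff] at h
    convert! h using 1
    rw [← integral_cauchy_torus hr0 hr hg hw]
    refine integral_congr_ae (.of_forall fun θ => ?_)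
    -- Expand the Cauchy kernel as a product of geometric series in `w i / ζ i`.
    have hx' : ∀ i, ‖w i / torusPoint r θ i‖ < 1 := fun i => by
      rw [norm_div, norm_torusPoint hr0.le, div_lt_one hr0]
      exact hw i
    have h3 := ((hasSum_prod_pow hx').2.mul_left (g (torusPoint r θ))).tsum_eq
    have h4 : ∀ α : Fin n → ℕ,
        F α θ = g (torusPoint r θ) * ∏ i, (w i / torusPoint r θ i) ^ α i := by
      intro α
      simp only [F, div_pow, Finset.prod_div_distrib]
      ring
    simp only [h4]
    rw [h3]
    congr 1
    refine Finset.prod_congr rfl fun i _ => ?_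
    have h5 := torusPoint_ne_zero hr0 θ i
    rw [one_sub_div h5, inv_div]

/-- The series with coefficients from the larger torus converges absolutely on the smaller one,
where integrating termwise recovers its coefficients. -/
theorem torusCoeff_eq_torusCoeff {n : ℕ} {r s : ℝ} (hr0 : 0 < r) (hrs : r < s) (hs : s < 1)
    {g : (Fin n → ℂ) → ℂ} (hg : DifferentiableOn ℂ g (ball 0 1)) (α : Fin n → ℕ) :
    torusCoeff n r g α = torusCoeff n s g α := by
  refine torusCoeff_eq_of_hasSum hr0 ?_ (fun w hw => ?_) α
  · have := (hasSum_torusCoeff (hr0.trans hrs) hs hg (w := fun _ => (r : ℂ))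
      (by simpa [abs_of_pos hr0] using fun _ => hrs)).1
    simpa [abs_of_pos hr0] using this
  · exact (hasSum_torusCoeff (hr0.trans hrs) hs hg fun i => (hw i).trans_lt hrs).2

/-- Power series expansion in the whole polydisk. -/
theorem hasSum_torusCoeff_half {n : ℕ} {g : (Fin n → ℂ) → ℂ}
    (hg : DifferentiableOn ℂ g (ball 0 1)) {w : Fin n → ℂ} (hw : ‖w‖ < 1) :
    Summable (fun α => ‖torusCoeff n (1 / 2) g α‖ * ∏ i, ‖w i‖ ^ α i) ∧
      HasSum (fun α => torusCoeff n (1 / 2) g α * ∏ i, w i ^ α i) (g w) := by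
  obtain ⟨s, hs, hs1⟩ := exists_between (max_lt hw one_half_lt_one)
  rw [max_lt_iff] at hs
  simp only [torusCoeff_eq_torusCoeff one_half_pos hs.2 hs1 hg]
  exact hasSum_torusCoeff (one_half_pos.trans hs.2) hs1 hg fun i =>
    (norm_le_pi_norm w i).trans_lt hs.1

end Cauchy

/-! ### Monomial coefficients on the infinite polydisk and expansion at finitely supported points.
-/

section Expansion

open MeasureTheory

theorem embed_apply (k : ℕ) (w : Fin k → ℂ) (j : ℕ) :
    embed k w j = if h : j < k then w ⟨j, h⟩ else 0 := by
  rw [embed, lp.coeFn_sum, Finset.sum_apply]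
  split_ifs with h
  · rw [Finset.sum_eq_single ⟨j, h⟩]
    · exact lp.single_apply_self _ _ _
    · intro i _ hi
      exact lp.single_apply_ne _ _ _ fun h' => hi (Fin.ext h'.symm)
    · simp
  · refine Finset.sum_eq_zero fun i _ => lp.single_apply_ne _ _ _ fun h' => h ?_
    rw [h']
    exact i.2

theorem embed_apply_fin {k : ℕ} (w : Fin k → ℂ) (i : Fin k) : embed k w i = w i := by
  rw [embed_apply, dif_pos i.2]

theorem norm_embed_le {k : ℕ} (w : Fin k → ℂ) : ‖embed k w‖ ≤ ‖w‖ := by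
  refine lp.norm_le_of_forall_le (norm_nonneg _) fun j => ?_
  rw [embed_apply]
  split_ifs
  · exact norm_le_pi_norm w _
  · simp

theorem embed_mem_polydisk {k : ℕ} {w : Fin k → ℂ} (hw : ‖w‖ < 1) : embed k w ∈ polydisk :=
  mem_ball_zero_iff.2 ((norm_embed_le w).trans_lt hw)

theorem differentiable_embed (k : ℕ) : Differentiable ℂ (embed k) := by
  have : embed k = fun w => ∑ i : Fin k,
      lp.singleContinuousLinearMap ℂ (fun _ : ℕ => ℂ) ∞ (i : ℕ) (w i) := rfl
  rw [this]
  fun_prop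

theorem IsHInfty.differentiableOn_embed {f : Linf → ℂ} (hf : IsHInfty f) (k : ℕ) :
    DifferentiableOn ℂ (fun w => f (embed k w)) (ball 0 1) :=
  hf.1.comp (differentiable_embed k).differentiableOn fun _ hw =>
    embed_mem_polydisk (mem_ball_zero_iff.1 hw)

theorem length_le_iff {α : ℕ →₀ ℕ} {n : ℕ} : length α ≤ n ↔ ∀ j, α j ≠ 0 → j < n := by
  simp [length, Finset.sup_le_iff]

/-- Extension of a multi-index by zeros. -/
def extendIndex {n : ℕ} (β : Fin n → ℕ) : ℕ →₀ ℕ :=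
  Finsupp.onFinset (Finset.range n) (fun j => if h : j < n then β ⟨j, h⟩ else 0) fun j hj => by
    by_contra h
    exact hj (dif_neg (by simpa using h))

theorem extendIndex_apply {n : ℕ} (β : Fin n → ℕ) (i : Fin n) : extendIndex β i = β i := by
  simp [extendIndex]

theorem extendIndex_injective (n : ℕ) : Function.Injective (extendIndex (n := n)) := by
  intro β γ h
  funext i
  rw [← extendIndex_apply β, h, extendIndex_apply]

theorem length_extendIndex_le {n : ℕ} (β : Fin n → ℕ) : length (extendIndex β) ≤ n := by
  rw [length_le_iff]
  intro j hj
  by_contra h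
  simp [extendIndex, h] at hj

theorem extendIndex_restrict {n : ℕ} {α : ℕ →₀ ℕ} (h : length α ≤ n) :
    extendIndex (fun i : Fin n => α i) = α := by
  ext j
  by_cases hj : j < n
  · exact extendIndex_apply (fun i : Fin n => α i) ⟨j, hj⟩
  · have : α j = 0 := by
      by_contra h0
      exact hj (length_le_iff.1 h j h0)
    simp [extendIndex, hj, this]

theorem monomial_embed {n : ℕ} (w : Fin n → ℂ) {α : ℕ →₀ ℕ} (h : length α ≤ n) :
    monomial (embed n w) α = ∏ i : Fin n, w i ^ α i := by
  rw [monomial, Finsupp.prod_of_support_subset α (s := Finset.range n) ?_ _ (by simp),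
    Finset.prod_range]
  · simp only [embed_apply_fin]
  · intro j hj
    rw [Finset.mem_range]
    exact length_le_iff.1 h j (by simpa using hj)

theorem monomial_embed_extendIndex {n : ℕ} (w : Fin n → ℂ) (β : Fin n → ℕ) :
    monomial (embed n w) (extendIndex β) = ∏ i, w i ^ β i := by
  rw [monomial_embed w (length_extendIndex_le β)]
  simp only [extendIndex_apply]

theorem monomial_embed_eq_zero {n : ℕ} (w : Fin n → ℂ) {α : ℕ →₀ ℕ} (h : ¬length α ≤ n) :
    monomial (embed n w) α = 0 := by
  rw [length_le_iff] at h
  push Not at h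
  obtain ⟨j, hj, hjn⟩ := h
  rw [monomial, Finsupp.prod, Finset.prod_eq_zero (Finsupp.mem_support_iff.2 hj)]
  rw [embed_apply, dif_neg hjn.not_gt, zero_pow hj]

theorem monomial_embed_eq_zero_of_notMem_range {n : ℕ} (w : Fin n → ℂ) {α : ℕ →₀ ℕ}
    (h : α ∉ Set.range (extendIndex (n := n))) : monomial (embed n w) α = 0 :=
  monomial_embed_eq_zero w fun h' => h ⟨_, extendIndex_restrict h'⟩

/-- On the torus `dw = i w dθ`, which cancels one power of each variable and the constant `i^k`. -/
theorem cauchyCoeff_eq_torusCoeff (k : ℕ) (f : Linf → ℂ) (α : ℕ →₀ ℕ) :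
    cauchyCoeff k f α = torusCoeff k (1 / 2) (fun w => f (embed k w)) fun i => α i := by
  rw [cauchyCoeff, torusCoeff, integral_torusMeasure, torusIntegral, ← integral_const_mul,
    ← integral_smul]
  congr 1
  funext θ
  have h1 : torusMap (0 : Fin k → ℂ) (fun _ => 1 / 2) θ = torusPoint (1 / 2) θ := by
    funext i
    simp [torusMap, torusPoint, circleMap]
  have h2 : (∏ i : Fin k, ((1 / 2 : ℝ) : ℂ) * Complex.exp (θ i * Complex.I) * Complex.I) =
      (∏ i, torusPoint (1 / 2) θ i) * Complex.I ^ k := by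
    rw [Finset.prod_mul_distrib]
    simp [torusPoint, circleMap]
  have h3 : ∏ i : Fin k, torusPoint (1 / 2) θ i ≠ 0 :=
    Finset.prod_ne_zero_iff.2 fun i _ => torusPoint_ne_zero one_half_pos θ i
  have h4 : (2 * (π : ℂ)) ≠ 0 := by simp [Real.pi_ne_zero]
  rw [h1, h2, Complex.real_smul, smul_eq_mul]
  simp only [pow_succ (torusPoint _ _ _), Finset.prod_mul_distrib, Complex.ofReal_pow,
    Complex.ofReal_inv, Complex.ofReal_mul, Complex.ofReal_ofNat]
  have h5 : ∏ i : Fin k, torusPoint (1 / 2) θ i ^ α i ≠ 0 :=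
    Finset.prod_ne_zero_iff.2 fun i _ => pow_ne_zero _ (torusPoint_ne_zero one_half_pos θ i)
  rw [mul_pow, inv_pow]
  field_simp

/-- Uniqueness of the coefficients of an absolutely convergent monomial expansion. -/
theorem cauchyCoeff_eq_of_hasSum {k : ℕ} {f : Linf → ℂ} {a : (ℕ →₀ ℕ) → ℂ}
    (ha : Summable fun α => ‖a α * monomial (embed k fun _ => 1 / 2) α‖)
    (hf : ∀ w : Fin k → ℂ, (∀ i, ‖w i‖ = 1 / 2) →
      HasSum (fun α => a α * monomial (embed k w) α) (f (embed k w)))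
    {β : ℕ →₀ ℕ} (hβ : length β ≤ k) : cauchyCoeff k f β = a β := by
  rw [cauchyCoeff_eq_torusCoeff,
    torusCoeff_eq_of_hasSum (a := fun γ => a (extendIndex γ)) one_half_pos ?_ fun w hw => ?_]
  · rw [extendIndex_restrict hβ]
  · have := ha.comp_injective (extendIndex_injective k)
    refine this.congr fun γ => ?_
    simp [monomial_embed_extendIndex, norm_prod]
  · have := ((extendIndex_injective k).hasSum_iff fun α hα => by
      rw [monomial_embed_eq_zero_of_notMem_range w hα, mul_zero]).2 (hf w hw)
    simpa [Function.comp_def, monomial_embed_extendIndex] using this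

theorem hasSum_cauchyCoeff {f : Linf → ℂ} (hf : IsHInfty f) {n : ℕ} {w : Fin n → ℂ}
    (hw : ‖w‖ < 1) :
    Summable (fun α => ‖cauchyCoeff n f α * monomial (embed n w) α‖) ∧
      HasSum (fun α => cauchyCoeff n f α * monomial (embed n w) α) (f (embed n w)) := by
  obtain ⟨h1, h2⟩ := hasSum_torusCoeff_half (hf.differentiableOn_embed n) hw
  have h0 : ∀ α ∉ Set.range (extendIndex (n := n)),
      cauchyCoeff n f α * monomial (embed n w) α = 0 := fun α hα => by
    rw [monomial_embed_eq_zero_of_notMem_range w hα, mul_zero]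
  constructor
  · rw [← (extendIndex_injective n).summable_iff fun α hα => by rw [h0 α hα, norm_zero]]
    refine h1.congr fun γ => ?_
    simp [monomial_embed_extendIndex, norm_prod, cauchyCoeff_eq_torusCoeff,
      extendIndex_apply]
  · rw [← (extendIndex_injective n).hasSum_iff h0]
    simpa [Function.comp_def, monomial_embed_extendIndex, cauchyCoeff_eq_torusCoeff,
      extendIndex_apply] using h2

theorem exists_embed_eq {k n : ℕ} (hkn : k ≤ n) (w : Fin k → ℂ) :
    ∃ v : Fin n → ℂ, ‖v‖ ≤ ‖w‖ ∧ embed n v = embed k w := by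
  refine ⟨fun i => embed k w i, ?_, ?_⟩
  · refine (pi_norm_le_iff_of_nonneg (norm_nonneg _)).2 fun i => ?_
    exact (lp.norm_apply_le_norm (by simp) _ _).trans (norm_embed_le w)
  · refine lp.ext (funext fun j => ?_)
    rw [embed_apply n]
    split_ifs with h
    · rfl
    · rw [embed_apply, dif_neg (by omega)]

theorem norm_lt_one_of_eq_half {k : ℕ} {w : Fin k → ℂ} (hw : ∀ i, ‖w i‖ = 1 / 2) : ‖w‖ < 1 :=
  ((pi_norm_le_iff_of_nonneg (by norm_num)).2 fun i => (hw i).le).trans_lt one_half_lt_one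

/-- Restricting the expansion in `n` variables to the first `length α` of them leaves the
coefficients unchanged, and coefficients are unique. -/
theorem cauchyCoeff_eq_monomialCoeff {f : Linf → ℂ} (hf : IsHInfty f) {n : ℕ} {α : ℕ →₀ ℕ}
    (h : length α ≤ n) : cauchyCoeff n f α = monomialCoeff f α := by
  symm
  refine cauchyCoeff_eq_of_hasSum (a := cauchyCoeff n f) ?_ (fun w hw => ?_) le_rfl
  · have hw : ‖(fun _ => 1 / 2 : Fin (length α) → ℂ)‖ < 1 := norm_lt_one_of_eq_half (by simp)
    obtain ⟨v, hv, he⟩ := exists_embed_eq h (fun _ => 1 / 2 : Fin (length α) → ℂ)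
    rw [← he]
    exact (hasSum_cauchyCoeff hf (hv.trans_lt hw)).1
  · obtain ⟨v, hv, he⟩ := exists_embed_eq h w
    rw [← he]
    exact (hasSum_cauchyCoeff hf (hv.trans_lt (norm_lt_one_of_eq_half hw))).2

/-- The monomial expansion of a function in `H_∞` converges absolutely at finitely supported
points of the polydisk, with the right sum. -/
theorem hasSum_monomialCoeff_embed {f : Linf → ℂ} (hf : IsHInfty f) {n : ℕ} {w : Fin n → ℂ}
    (hw : ‖w‖ < 1) :
    Summable (fun α => ‖monomialCoeff f α * monomial (embed n w) α‖) ∧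
      HasSum (fun α => monomialCoeff f α * monomial (embed n w) α) (f (embed n w)) := by
  have h : ∀ α, cauchyCoeff n f α * monomial (embed n w) α =
      monomialCoeff f α * monomial (embed n w) α := by
    intro α
    by_cases hα : length α ≤ n
    · rw [cauchyCoeff_eq_monomialCoeff hf hα]
    · simp [monomial_embed_eq_zero w hα]
  simpa only [h] using hasSum_cauchyCoeff hf hw

end Expansion

/-! ### The sufficient condition for monomial convergence. -/

section Sufficiency

theorem norm_monomial_embed {n : ℕ} (z : Linf) {α : ℕ →₀ ℕ} (hα : length α ≤ n) :
    ‖monomial z α‖ = ∏ i : Fin n, ‖z i‖ ^ α i := by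
  rw [monomial, Finsupp.prod_of_support_subset α (s := Finset.range n) ?_ _ (by simp),
    Finset.prod_range, norm_prod]
  · simp only [norm_pow]
  · intro j hj
    rw [Finset.mem_range]
    exact length_le_iff.1 hα j (by simpa using hj)

/-- A polynomial in `n` variables which has prescribed dilated coefficients and is almost bounded
by the supremum of `f`. -/
theorem exists_box_norm_le {f : Linf → ℂ} (hf : IsHInfty f) {C : ℝ}
    (hC : ∀ z ∈ polydisk, ‖f z‖ ≤ C) (n : ℕ) {s : ℝ} (hs0 : 0 ≤ s) (hs1 : s < 1) {ε : ℝ}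
    (hε : 0 < ε) (Φ : Finset (Fin n → ℕ)) :
    ∃ N : ℕ, (∀ γ ∈ Φ, ∀ i, γ i < N) ∧ ∀ w : Fin n → ℂ, (∀ i, ‖w i‖ ≤ 1) →
      ‖∑ α : Fin n → Fin N, monomialCoeff f (extendIndex fun i => (α i : ℕ)) *
        (∏ i, (s : ℂ) ^ (α i : ℕ)) * ∏ i, w i ^ (α i : ℕ)‖ ≤ C + ε := by
  have hnorm : ∀ w : Fin n → ℂ, (∀ i, ‖w i‖ ≤ 1) → ‖fun i => (s : ℂ) * w i‖ < 1 := fun w hw => by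
    refine lt_of_le_of_lt ((pi_norm_le_iff_of_nonneg hs0).2 fun i => ?_) hs1
    rw [norm_mul, Complex.norm_real, Real.norm_of_nonneg hs0]
    exact mul_le_of_le_one_right hs0 (hw i)
  let F : (Fin n → ℕ) → (Fin n → ℂ) → ℂ := fun γ w =>
    monomialCoeff f (extendIndex γ) * (∏ i, (s : ℂ) ^ γ i) * ∏ i, w i ^ γ i
  have hFeq : ∀ γ w, F γ w = monomialCoeff f (extendIndex γ) *
      monomial (embed n fun i => (s : ℂ) * w i) (extendIndex γ) := by
    intro γ w
    simp only [F, monomial_embed_extendIndex, mul_pow, Finset.prod_mul_distrib, mul_assoc]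
  have hsum : ∀ w : Fin n → ℂ, (∀ i, ‖w i‖ ≤ 1) →
      HasSum (fun γ => F γ w) (f (embed n fun i => (s : ℂ) * w i)) := by
    intro w hw
    have h := (hasSum_monomialCoeff_embed hf (hnorm w hw)).2
    rw [← (extendIndex_injective n).hasSum_iff fun α hα => by
      rw [monomial_embed_eq_zero_of_notMem_range _ hα, mul_zero]] at h
    simpa only [Function.comp_def, ← hFeq] using h
  have hu : Summable fun γ => ‖F γ fun _ => 1‖ := by
    have h := (hasSum_monomialCoeff_embed hf (hnorm (fun _ => 1) (by simp))).1.comp_injective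
      (extendIndex_injective n)
    simpa only [Function.comp_def, ← hFeq] using h
  -- Dilation by `s < 1` makes the series uniformly convergent on the closed polydisk, so a large
  -- enough box of exponents approximates `f (s w)` within `ε`.
  have hunif := tendstoUniformlyOn_tsum (s := {w : Fin n → ℂ | ∀ i, ‖w i‖ ≤ 1}) hu
    (f := F) fun γ w hw => by
      simp only [F, norm_mul, norm_prod, norm_pow, norm_one, one_pow, Finset.prod_const_one]
      refine mul_le_mul_of_nonneg_left ?_ (by positivity)
      exact Finset.prod_le_one (fun i _ => by positivity) fun i _ =>
        pow_le_one₀ (norm_nonneg _) (hw i)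
  obtain ⟨T, hT⟩ := Filter.eventually_atTop.1 (Metric.tendstoUniformlyOn_iff.1 hunif ε hε)
  let N := (T ∪ Φ).sup (fun γ => Finset.univ.sup γ) + 1
  have hN : ∀ γ ∈ T ∪ Φ, ∀ i, γ i < N := by
    intro γ hγ i
    refine Nat.lt_succ_of_le ((Finset.le_sup (f := γ) (Finset.mem_univ i)).trans ?_)
    exact Finset.le_sup (f := fun γ => Finset.univ.sup γ) hγ
  refine ⟨N, fun γ hγ => hN γ (Finset.mem_union_right _ hγ), fun w hw => ?_⟩
  let e : (Fin n → Fin N) ↪ (Fin n → ℕ) := ⟨fun α i => α i, fun α β h => by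
    funext i
    exact Fin.ext (congrFun h i)⟩
  have h1 := hT (Finset.univ.map e) (fun γ hγ => by
    rw [Finset.mem_map]
    exact ⟨fun i => ⟨γ i, hN γ (Finset.mem_union_left _ hγ) i⟩, Finset.mem_univ _, rfl⟩) w hw
  rw [(hsum w hw).tsum_eq, Finset.sum_map, dist_eq_norm, norm_sub_rev] at h1
  have h2 := hC _ (embed_mem_polydisk (hnorm w hw))
  have h3 := norm_le_norm_add_norm_sub' (∑ α, F (e α) w) (f (embed n fun i => (s : ℂ) * w i))
  have h4 : ‖∑ α, F (e α) w‖ ≤ C + ε := by linarith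
  exact h4

/-- The polynomial estimate applied to truncations of `f (s w)` bounded by `C + ε`, followed by `ε →
0` and `s → 1`. The bound is independent of `Φ`, hence gives summability. -/
theorem sum_norm_monomialCoeff_le {f : Linf → ℂ} (hf : IsHInfty f) {C : ℝ}
    (hC : ∀ z ∈ polydisk, ‖f z‖ ≤ C) {z : Linf} {t K : ℝ} (ht0 : 0 < t) (ht1 : t < 1)
    (hzt : ∀ j, ‖z j‖ < t) (hK0 : 0 ≤ K)
    (hK : ∀ (R : Finset ℕ) (k : ℕ), (∀ j ∈ R, ‖z k‖ ≤ ‖z j‖) →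
      ‖z k‖ * ∏ j ∈ R, (1 - (‖z j‖ / t) ^ 2)⁻¹ ≤ K) (Φ : Finset (ℕ →₀ ℕ)) :
    ∑ α ∈ Φ, ‖monomialCoeff f α * monomial z α‖ ≤ C + 2 * K * C / (1 - t) := by
  have hC0 : 0 ≤ C := (norm_nonneg _).trans (hC 0 (by simp [polydisk]))
  obtain ⟨n, hn⟩ : ∃ n, ∀ α ∈ Φ, length α ≤ n := ⟨Φ.sup length, fun α hα => Finset.le_sup hα⟩
  have key : ∀ s : ℝ, 0 ≤ s → s < 1 → ∀ ε : ℝ, 0 < ε →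
      ∑ α ∈ Φ, ‖monomialCoeff f α‖ * ((∏ i : Fin n, s ^ α i) * ∏ i : Fin n, ‖z i‖ ^ α i) ≤
        (C + ε) + 2 * K * (C + ε) / (1 - t) := by
    intro s hs0 hs1 ε hε
    obtain ⟨N, hN, hP⟩ := exists_box_norm_le hf hC n hs0 hs1 hε
      (Φ.image fun α (i : Fin n) => α i)
    have h := sum_norm_mul_prod_le (fun α : Fin n → Fin N =>
      monomialCoeff f (extendIndex fun i => (α i : ℕ)) * ∏ i, (s : ℂ) ^ (α i : ℕ)) ht0 ht1
      (by positivity) hP (x := fun j => ‖z j‖) (fun j => norm_nonneg _) (fun j => hzt j) hK0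
      fun k => by
        have := hK ((Finset.univ.filter fun j : Fin n => ‖z k‖ ≤ ‖z j‖).map Fin.valEmbedding) k
          (by simp)
        rwa [Finset.prod_map] at this
    refine le_trans ?_ h
    let G : (ℕ →₀ ℕ) → ℝ := fun α =>
      ‖monomialCoeff f α‖ * ((∏ i : Fin n, s ^ α i) * ∏ i : Fin n, ‖z i‖ ^ α i)
    let e : (Fin n → Fin N) ↪ (ℕ →₀ ℕ) := ⟨fun α => extendIndex fun i => (α i : ℕ), fun α β h => by
      have := extendIndex_injective n h
      funext i
      exact Fin.ext (congrFun this i)⟩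
    have h1 : ∑ α : Fin n → Fin N, ‖monomialCoeff f (extendIndex fun i => (α i : ℕ)) *
        ∏ i, (s : ℂ) ^ (α i : ℕ)‖ * ∏ j : Fin n, ‖z j‖ ^ (α j : ℕ) =
        ∑ α ∈ Finset.univ.map e, G α := by
      rw [Finset.sum_map]
      refine Finset.sum_congr rfl fun α _ => ?_
      have he : ∀ i : Fin n, e α i = α i := extendIndex_apply fun i => (α i : ℕ)
      have he' : e α = extendIndex fun i => (α i : ℕ) := rfl
      simp only [G, he, norm_mul, norm_prod, norm_pow, Complex.norm_real, Real.norm_of_nonneg hs0,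
        mul_assoc]
      rw [he']
    rw [h1]
    refine Finset.sum_le_sum_of_subset_of_nonneg (f := G) ?_ fun α _ _ => by
      simp only [G]
      positivity
    intro α hα
    rw [Finset.mem_map]
    refine ⟨fun i => ⟨α i, hN _ (Finset.mem_image_of_mem _ hα) i⟩, Finset.mem_univ _, ?_⟩
    exact extendIndex_restrict (hn α hα)
  have key2 : ∀ s : ℝ, 0 ≤ s → s < 1 →
      ∑ α ∈ Φ, ‖monomialCoeff f α‖ * ((∏ i : Fin n, s ^ α i) * ∏ i : Fin n, ‖z i‖ ^ α i) ≤
        C + 2 * K * C / (1 - t) := by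
    intro s hs0 hs1
    have hc : Continuous fun ε : ℝ => (C + ε) + 2 * K * (C + ε) / (1 - t) := by fun_prop
    have hlim := (hc.tendsto 0).mono_left (nhdsWithin_le_nhds (s := Set.Ioi 0))
    simp only [add_zero] at hlim
    refine ge_of_tendsto hlim ?_
    filter_upwards [self_mem_nhdsWithin] with ε hε
    exact key s hs0 hs1 ε hε
  have hc : Continuous fun s : ℝ => ∑ α ∈ Φ, ‖monomialCoeff f α‖ *
      ((∏ i : Fin n, s ^ α i) * ∏ i : Fin n, ‖z i‖ ^ α i) := by fun_prop
  have hlim := (hc.tendsto 1).mono_left (nhdsWithin_le_nhds (s := Set.Iio 1))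
  have h := le_of_tendsto hlim (by
    filter_upwards [Ioo_mem_nhdsLT zero_lt_one] with s hs
    exact key2 s hs.1.le hs.2)
  refine le_of_eq_of_le (Finset.sum_congr rfl fun α hα => ?_) h
  rw [norm_mul, norm_monomial_embed z (hn α hα)]
  simp

theorem bddAbove_norm_compl (z : Linf) (J : Finset ℕ) :
    BddAbove (Set.range fun j : {j : ℕ // j ∉ J} => ‖z j‖) :=
  ⟨‖z‖, by
    rintro _ ⟨j, rfl⟩
    exact lp.norm_apply_le_norm (by simp) z j⟩

theorem bddBelow_decRearr (z : Linf) (n : ℕ) :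
    BddBelow {t : ℝ | ∃ J : Finset ℕ, J.card < n ∧ t = ⨆ j : {j : ℕ // j ∉ J}, ‖z j‖} :=
  ⟨0, by
    rintro _ ⟨J, _, rfl⟩
    exact Real.iSup_nonneg fun _ => norm_nonneg _⟩

theorem le_decRearr {z : Linf} {R : Finset ℕ} (hR : R.Nonempty) {u : ℝ}
    (hu : ∀ j ∈ R, u ≤ ‖z j‖) : u ≤ decRearr z R.card := by
  refine le_csInf ⟨_, ∅, by simpa using hR, rfl⟩ ?_
  rintro _ ⟨J, hJ, rfl⟩
  obtain ⟨j, hjR, hjJ⟩ := Finset.exists_mem_notMem_of_card_lt_card hJ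
  exact (hu j hjR).trans (le_ciSup (bddAbove_norm_compl z J) ⟨j, hjJ⟩)

theorem decRearr_nonneg (z : Linf) (n : ℕ) : 0 ≤ decRearr z n := by
  refine Real.sInf_nonneg ?_
  rintro _ ⟨J, _, rfl⟩
  exact Real.iSup_nonneg fun _ => norm_nonneg _

/-- Remove an element of `R` of least modulus: by `le_decRearr` that modulus is at most the
rearrangement at the cardinality of `R`. -/
theorem sum_sq_norm_le_sum_sq_decRearr (z : Linf) (R : Finset ℕ) :
    ∑ j ∈ R, ‖z j‖ ^ 2 ≤ ∑ j ∈ Finset.Icc 1 R.card, decRearr z j ^ 2 := by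
  induction hm : R.card generalizing R with
  | zero => simp [Finset.card_eq_zero.1 hm]
  | succ m ih =>
    have hR : R.Nonempty := Finset.card_pos.1 (by omega)
    obtain ⟨k, hk, hmin⟩ := Finset.exists_min_image R (fun j => ‖z j‖) hR
    rw [← Finset.add_sum_erase R _ hk, Finset.sum_Icc_succ_top (by omega), add_comm, ← hm]
    refine add_le_add (ih (R.erase k) (by rw [Finset.card_erase_of_mem hk, hm]; rfl)) ?_
    exact pow_le_pow_left₀ (norm_nonneg _) (le_decRearr hR hmin) 2

theorem exists_bound_of_logLimsup_lt {z : Linf} (h : logLimsup z < ((1 / 2 : ℝ) : EReal)) :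
    ∃ L : ℝ, 0 < L ∧ L < 1 / 2 ∧ ∃ N : ℕ, 2 ≤ N ∧ ∀ R : Finset ℕ, N ≤ R.card →
      ∑ j ∈ R, ‖z j‖ ^ 2 ≤ L * Real.log R.card := by
  obtain ⟨L, h1, h2⟩ := EReal.exists_between_coe_real h
  have h3 := Filter.eventually_lt_of_limsup_lt h1
  obtain ⟨N, hN⟩ := Filter.eventually_atTop.1 h3
  have hL : L < 1 / 2 := by exact_mod_cast h2
  -- The value `1 / 4` only ensures a positive constant below `1 / 2`; cardinality at least `2`
  -- makes the logarithm positive.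
  refine ⟨max L (1 / 4), by positivity, max_lt hL (by norm_num), max N 2, le_max_right _ _,
    fun R hR => ?_⟩
  have h4 := hN R.card ((le_max_left _ _).trans hR)
  have h5 : (2 : ℝ) ≤ R.card := by exact_mod_cast (le_max_right N 2).trans hR
  have hlog : 0 < Real.log R.card := Real.log_pos (by linarith)
  rw [EReal.coe_lt_coe_iff, one_div_mul_eq_div, div_lt_iff₀ hlog] at h4
  calc _ ≤ _ := sum_sq_norm_le_sum_sq_decRearr z R
    _ ≤ L * Real.log R.card := h4.le
    _ ≤ _ := by
      gcongr
      exact le_max_left _ _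

/-- A set of `m` such indices forces `η m ≤ L log m` once `m ≥ N`, impossible for large `m`. -/
theorem exists_card_bound {z : Linf} {L : ℝ} {N : ℕ}
    (hL : ∀ R : Finset ℕ, N ≤ R.card → ∑ j ∈ R, ‖z j‖ ^ 2 ≤ L * Real.log R.card) {η : ℝ}
    (hη : 0 < η) : ∃ M : ℕ, ∀ R : Finset ℕ, (∀ j ∈ R, η ≤ ‖z j‖ ^ 2) → R.card < M := by
  have h1 : Filter.Tendsto (fun m : ℕ => L * (Real.log m / m)) Filter.atTop (nhds (L * 0)) := by
    refine Filter.Tendsto.const_mul _ ?_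
    have := Real.isLittleO_log_id_atTop.tendsto_div_nhds_zero
    exact this.comp tendsto_natCast_atTop_atTop
  rw [mul_zero] at h1
  obtain ⟨M, hM⟩ := Filter.eventually_atTop.1 (h1.eventually (gt_mem_nhds hη))
  refine ⟨max (max M N) 1, fun R hR => ?_⟩
  by_contra! hc
  have hcard1 : (1 : ℕ) ≤ R.card := (le_max_right _ _).trans hc
  have h2 := hM R.card (((le_max_left _ _).trans (le_max_left _ _)).trans hc)
  have h3 := hL R (((le_max_right _ _).trans (le_max_left _ _)).trans hc)
  have h4 := Finset.card_nsmul_le_sum R _ _ hR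
  have h5 : (0 : ℝ) < R.card := by exact_mod_cast hcard1
  rw [← mul_div_assoc, div_lt_iff₀ h5] at h2
  rw [nsmul_eq_mul] at h4
  linarith [mul_comm η (R.card : ℝ)]

/-- With `m` the cardinality of `R`, the product grows at most like `m ^ (c L / t²)`, while
minimality of `|z k|` gives `|z k|² m ≤ L log m`. An exponent below `1/2` makes the decay win. -/
theorem exists_prod_bound {z : Linf} {L : ℝ} (hL0 : 0 < L) {N : ℕ} (hN : 2 ≤ N)
    (hL : ∀ R : Finset ℕ, N ≤ R.card → ∑ j ∈ R, ‖z j‖ ^ 2 ≤ L * Real.log R.card)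
    {t : ℝ} (ht0 : 0 < t) (ht1 : t < 1) (hzt : ‖z‖ < t) (hLt : L / t ^ 2 < 1 / 2) :
    ∃ K : ℝ, 0 ≤ K ∧ ∀ (R : Finset ℕ) (k : ℕ), (∀ j ∈ R, ‖z k‖ ≤ ‖z j‖) →
      ‖z k‖ * ∏ j ∈ R, (1 - (‖z j‖ / t) ^ 2)⁻¹ ≤ K := by
  obtain ⟨c, hc1, hc2⟩ : ∃ c : ℝ, 1 < c ∧ c * (L / t ^ 2) < 1 / 2 := by
    have hpos : 0 < L / t ^ 2 := by positivity
    obtain ⟨c, h1, h2⟩ := exists_between ((one_lt_div hpos).2 hLt)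
    exact ⟨c, h1, (lt_div_iff₀ hpos).1 h2⟩
  set y : ℕ → ℝ := fun j => (‖z j‖ / t) ^ 2 with hy
  have hy0 : ∀ j, 0 ≤ y j := fun j => by positivity
  set q : ℝ := (‖z‖ / t) ^ 2 with hq
  have hyq : ∀ j, y j ≤ q := fun j => by
    have := lp.norm_apply_le_norm (by simp) z j
    simp only [hy, hq]
    gcongr
  have hq1 : q < 1 := pow_lt_one₀ (by positivity) ((div_lt_one ht0).2 hzt) two_ne_zero
  set Q : ℝ := (1 - q)⁻¹ with hQ
  have hQ1 : 1 ≤ Q := (one_le_inv₀ (by linarith)).2 (by have := (hy0 0).trans (hyq 0); linarith)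
  have hQ0 : 0 ≤ Q := zero_le_one.trans hQ1
  have hyQ : ∀ j, (1 - y j)⁻¹ ≤ Q := fun j =>
    inv_anti₀ (by linarith) (by linarith [hyq j])
  have hyinv0 : ∀ j, 0 ≤ (1 - y j)⁻¹ := fun j => inv_nonneg.2 (by linarith [hyq j])
  -- For `y < η`, `1 / (1 - y) = 1 + y / (1 - y) ≤ exp (c y)`. The remaining factors are at most `Q`
  -- each, and fewer than `M` in number.
  set η : ℝ := 1 - c⁻¹ with hη
  have hη0 : 0 < η := sub_pos.2 (inv_lt_one_of_one_lt₀ hc1)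
  obtain ⟨M, hM⟩ := exists_card_bound hL (η := η * t ^ 2) (by positivity)
  have hfac : ∀ j, (1 - y j)⁻¹ ≤ (if η ≤ y j then Q else 1) * Real.exp (c * y j) := by
    intro j
    have hexp : 1 ≤ Real.exp (c * y j) := Real.one_le_exp (by have := hy0 j; positivity)
    split_ifs with h
    · exact (hyQ j).trans (le_mul_of_one_le_right hQ0 hexp)
    · rw [one_mul]
      have h1 : 0 < 1 - y j := by linarith [hyq j]
      have h2 : (1 - y j)⁻¹ ≤ c := by
        rw [inv_le_comm₀ h1 (by linarith)]
        linarith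
      calc (1 - y j)⁻¹ = y j * (1 - y j)⁻¹ + 1 := by field_simp; ring
        _ ≤ Real.exp (y j * (1 - y j)⁻¹) := Real.add_one_le_exp _
        _ ≤ Real.exp (c * y j) := by
          rw [mul_comm c]
          exact Real.exp_le_exp.2 (mul_le_mul_of_nonneg_left h2 (hy0 j))
  have hprod : ∀ R : Finset ℕ, ∏ j ∈ R, (1 - y j)⁻¹ ≤
      Q ^ M * Real.exp (c * ((∑ j ∈ R, ‖z j‖ ^ 2) / t ^ 2)) := by
    intro R
    calc ∏ j ∈ R, (1 - y j)⁻¹ ≤ ∏ j ∈ R, ((if η ≤ y j then Q else 1) * Real.exp (c * y j)) :=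
          Finset.prod_le_prod (fun j _ => hyinv0 j) fun j _ => hfac j
      _ = Q ^ (R.filter fun j => η ≤ y j).card *
          Real.exp (c * ((∑ j ∈ R, ‖z j‖ ^ 2) / t ^ 2)) := by
          rw [Finset.prod_mul_distrib, ← Finset.prod_filter, Finset.prod_const, ← Real.exp_sum,
            ← Finset.mul_sum, Finset.sum_div]
          simp only [hy, div_pow]
      _ ≤ _ := by
          gcongr
          refine (hM _ fun j hj => ?_).le
          have := (Finset.mem_filter.1 hj).2
          simp only [hy, div_pow] at this
          rwa [le_div_iff₀ (by positivity)] at this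
  -- The surplus of the exponent after squaring; `m ^ (-δ)` absorbs the factor `log m`.
  set δ : ℝ := 1 - 2 * (c * (L / t ^ 2)) with hδ
  have hδ0 : 0 < δ := by linarith
  refine ⟨max (Q ^ M * √(L / δ)) (Q ^ N), by positivity, fun R k hk => ?_⟩
  rcases le_or_gt N R.card with hR | hR
  · refine le_max_of_le_left ?_
    have hcard : (2 : ℝ) ≤ R.card := by exact_mod_cast hN.trans hR
    have hcard0 : (0 : ℝ) < R.card := by linarith
    have hsum := hL R hR
    set l := Real.log R.card with hl
    have hexp : Real.exp l = R.card := Real.exp_log hcard0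
    have hzk : ‖z k‖ ^ 2 * Real.exp l ≤ L * l := by
      have h4 := Finset.card_nsmul_le_sum R (fun j => ‖z j‖ ^ 2) (‖z k‖ ^ 2) fun j hj => by
        have := hk j hj
        gcongr
      rw [nsmul_eq_mul] at h4
      rw [hexp]
      linarith [mul_comm (‖z k‖ ^ 2) (R.card : ℝ)]
    have hzk2 : ‖z k‖ * Real.exp (c * (L * l / t ^ 2)) ≤ √(L / δ) := by
      refine Real.le_sqrt_of_sq_le ?_
      have h5 : Real.exp (c * (L * l / t ^ 2)) ^ 2 = Real.exp l * Real.exp (-(δ * l)) := by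
        rw [← Real.exp_nat_mul, ← Real.exp_add, hδ]
        congr 1
        push_cast
        ring
      have h6 : δ * l ≤ Real.exp (δ * l) := by linarith [Real.add_one_le_exp (δ * l)]
      have h7 : Real.exp (-(δ * l)) * Real.exp (δ * l) = 1 := by
        rw [← Real.exp_add, neg_add_cancel, Real.exp_zero]
      rw [mul_pow, h5, ← mul_assoc, le_div_iff₀ hδ0]
      calc ‖z k‖ ^ 2 * Real.exp l * Real.exp (-(δ * l)) * δ
          ≤ L * l * Real.exp (-(δ * l)) * δ := by gcongr
        _ = L * (Real.exp (-(δ * l)) * (δ * l)) := by ring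
        _ ≤ L * (Real.exp (-(δ * l)) * Real.exp (δ * l)) := by gcongr
        _ = L := by rw [h7, mul_one]
    calc ‖z k‖ * ∏ j ∈ R, (1 - y j)⁻¹
        ≤ ‖z k‖ * (Q ^ M * Real.exp (c * ((∑ j ∈ R, ‖z j‖ ^ 2) / t ^ 2))) := by
          gcongr
          exact hprod R
      _ ≤ ‖z k‖ * (Q ^ M * Real.exp (c * (L * l / t ^ 2))) := by gcongr
      _ = Q ^ M * (‖z k‖ * Real.exp (c * (L * l / t ^ 2))) := by ring
      _ ≤ _ := by gcongr
  · refine le_max_of_le_right ?_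
    have hz1 : ‖z k‖ ≤ 1 :=
      ((lp.norm_apply_le_norm (by simp) z k).trans_lt (hzt.trans ht1)).le
    calc ‖z k‖ * ∏ j ∈ R, (1 - y j)⁻¹ ≤ 1 * ∏ _j ∈ R, Q := by
          refine mul_le_mul hz1 (Finset.prod_le_prod (fun j _ => hyinv0 j) fun j _ => hyQ j)
            (Finset.prod_nonneg fun j _ => hyinv0 j) zero_le_one
      _ = Q ^ R.card := by rw [one_mul, Finset.prod_const]
      _ ≤ Q ^ N := pow_le_pow_right₀ hQ1 hR.le

/-- The truncation of a sequence to its first `n` coordinates. -/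
def truncate (n : ℕ) (z : Linf) : Linf := embed n fun i => z i

theorem norm_truncate_coord_le (n : ℕ) (z : Linf) : ‖fun i : Fin n => z i‖ ≤ ‖z‖ :=
  (pi_norm_le_iff_of_nonneg (norm_nonneg _)).2 fun i => lp.norm_apply_le_norm (by simp) z i

theorem tendsto_truncate {z : Linf} (h : ∀ η : ℝ, 0 < η → {j | η ≤ ‖z j‖}.Finite) :
    Filter.Tendsto (fun n => truncate n z) Filter.atTop (nhds z) := by
  refine Metric.tendsto_atTop.2 fun ε hε => ?_
  obtain ⟨B, hB⟩ := (h (ε / 2) (by positivity)).bddAbove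
  refine ⟨B + 1, fun n hn => ?_⟩
  rw [dist_eq_norm]
  refine lt_of_le_of_lt (lp.norm_le_of_forall_le (C := ε / 2) (by positivity) fun j => ?_)
    (by linarith)
  rw [lp.coeFn_sub, Pi.sub_apply, truncate, embed_apply]
  split_ifs with hj
  · simp only [sub_self, norm_zero]
    positivity
  · rw [zero_sub, norm_neg]
    by_contra! hc
    have : j ≤ B := hB hc.le
    omega

theorem monomial_truncate (n : ℕ) (z : Linf) (α : ℕ →₀ ℕ) :
    monomial (truncate n z) α = if length α ≤ n then monomial z α else 0 := by
  split_ifs with h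
  · rw [truncate, monomial_embed _ h, monomial,
      Finsupp.prod_of_support_subset α (s := Finset.range n) ?_ _ (by simp), Finset.prod_range]
    intro j hj
    rw [Finset.mem_range]
    exact length_le_iff.1 h j (by simpa using hj)
  · exact monomial_embed_eq_zero _ h

/-- Points whose decreasing rearrangement has small logarithmic means are points of monomial
convergence. -/
theorem mem_monHInfty_of_logLimsup_lt {z : Linf} (hz : z ∈ polydisk)
    (h : logLimsup z < ((1 / 2 : ℝ) : EReal)) : z ∈ monHInfty := by
  refine ⟨hz, fun f hf => ?_⟩
  obtain ⟨L, hL0, hL1, N, hN, hL⟩ := exists_bound_of_logLimsup_lt h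
  have hz1 : ‖z‖ < 1 := mem_ball_zero_iff.1 hz
  have hsq : √(2 * L) < 1 := by
    rw [Real.sqrt_lt' one_pos]
    linarith
  -- `t > ‖z‖` keeps the products finite and `t > √(2 L)` keeps `L / t²` below `1 / 2`.
  obtain ⟨t, ht, ht1⟩ := exists_between (max_lt hz1 hsq)
  obtain ⟨hzt, hLt⟩ := max_lt_iff.1 ht
  have ht0 : 0 < t := (norm_nonneg z).trans_lt hzt
  have hLt' : L / t ^ 2 < 1 / 2 := by
    rw [Real.sqrt_lt' ht0] at hLt
    rw [div_lt_iff₀ (by positivity)]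
    linarith
  obtain ⟨K, hK0, hK⟩ := exists_prod_bound hL0 hN hL ht0 ht1 hzt hLt'
  obtain ⟨C, hC⟩ := hf.2
  have hsum : Summable fun α => ‖monomialCoeff f α * monomial z α‖ :=
    summable_of_sum_le (fun _ => norm_nonneg _) fun Φ => sum_norm_monomialCoeff_le hf hC ht0 ht1
      (fun j => (lp.norm_apply_le_norm (by simp) z j).trans_lt hzt) hK0 hK Φ
  refine ⟨hsum, ?_⟩
  -- So `z` is a null sequence; its truncations converge in norm and continuity of `f` identifies
  -- the sum.
  have hfin : ∀ η : ℝ, 0 < η → {j | η ≤ ‖z j‖}.Finite := by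
    intro η hη
    obtain ⟨M, hM⟩ := exists_card_bound hL (η := η ^ 2) (by positivity)
    by_contra hinf
    obtain ⟨R, hR, hcard⟩ := Set.Infinite.exists_subset_card_eq hinf M
    exact (hM R fun j hj => pow_le_pow_left₀ hη.le (hR hj) 2).ne hcard
  have htr := tendsto_truncate hfin
  have hlim1 : Filter.Tendsto (fun n => f (truncate n z)) Filter.atTop (nhds (f z)) :=
    ((hf.1.differentiableAt (isOpen_ball.mem_nhds hz)).continuousAt.tendsto).comp htr
  have hlim2 : Filter.Tendsto
      (fun n => ∑' α, monomialCoeff f α * monomial (truncate n z) α) Filter.atTop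
      (nhds (∑' α, monomialCoeff f α * monomial z α)) := by
    refine tendsto_tsum_of_dominated_convergence hsum (fun α => ?_) (.of_forall fun n α => ?_)
    · refine tendsto_const_nhds.congr' ?_
      filter_upwards [Filter.eventually_ge_atTop (length α)] with n hn
      rw [monomial_truncate, if_pos hn]
    · rw [monomial_truncate]
      split_ifs
      · rfl
      · simpa using mul_nonneg (norm_nonneg _) (norm_nonneg _)
  have heq : ∀ n, ∑' α, monomialCoeff f α * monomial (truncate n z) α = f (truncate n z) :=
    fun n => (hasSum_monomialCoeff_embed hf
      ((norm_truncate_coord_le n z).trans_lt hz1)).2.tsum_eq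
  simp only [heq] at hlim2
  rw [tendsto_nhds_unique hlim1 hlim2]
  exact hsum.of_norm.hasSum

end Sufficiency

/-! ### Random signs and polynomials with small supremum norm. -/

section RandomPolynomial

/-- The sign attached to a Boolean. -/
def boolSign (b : Bool) : ℝ := if b then 1 else -1

theorem abs_boolSign (b : Bool) : |boolSign b| = 1 := by
  cases b <;> simp [boolSign]

/-- Moment generating function of a Rademacher sum, up to normalisation: it factorises, and `cosh x
≤ exp (x² / 2)`. -/
theorem sum_exp_rademacher_le {Λ : Type*} [Fintype Λ] [DecidableEq Λ] (u : Λ → ℝ) (l : ℝ) :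
    ∑ e : Λ → Bool, Real.exp (l * ∑ α, boolSign (e α) * u α) ≤
      2 ^ Fintype.card Λ * Real.exp (l ^ 2 * (∑ α, u α ^ 2) / 2) := by
  calc ∑ e : Λ → Bool, Real.exp (l * ∑ α, boolSign (e α) * u α)
      = ∑ e : Λ → Bool, ∏ α, Real.exp (l * (boolSign (e α) * u α)) := by
        simp only [Finset.mul_sum, Real.exp_sum]
    _ = ∏ α, ∑ b : Bool, Real.exp (l * (boolSign b * u α)) :=
        (Fintype.prod_sum fun α b => Real.exp (l * (boolSign b * u α))).symm
    _ ≤ ∏ α, (2 * Real.exp ((l * u α) ^ 2 / 2)) := by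
        refine Finset.prod_le_prod (fun α _ => by positivity) fun α _ => ?_
        have := Real.cosh_le_exp_half_sq (l * u α)
        rw [Real.cosh_eq] at this
        simp only [Fintype.sum_bool, boolSign, if_true, Bool.false_eq_true, if_false, one_mul]
        rw [neg_one_mul, mul_neg]
        linarith
    _ = _ := by
        rw [Finset.prod_mul_distrib, Finset.prod_const, Finset.card_univ, ← Real.exp_sum,
          ← Finset.sum_div, Finset.mul_sum]
        simp only [mul_pow]

/-- Maximal inequality: some choice of signs makes finitely many signed sums small at once. -/
theorem exists_signs_abs_sum_le {ι Λ : Type*} [Fintype ι] [Nonempty ι] [Fintype Λ] {u : ι → Λ → ℝ}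
    {v : ℝ} (hv : 0 < v) (hu : ∀ i, ∑ α, u i α ^ 2 ≤ v) :
    ∃ e : Λ → Bool, ∀ i, |∑ α, boolSign (e α) * u i α| ≤
      √(2 * v * Real.log (2 * Fintype.card ι)) := by
  classical
  have hcard : (1 : ℝ) ≤ Fintype.card ι := by exact_mod_cast Fintype.card_pos
  set T := Real.log (2 * Fintype.card ι) with hT
  have hT0 : 0 < T := Real.log_pos (by linarith)
  set s := √(2 * v * T) with hs
  have hs0 : 0 < s := Real.sqrt_pos.2 (by positivity)
  have hs2 : s ^ 2 = 2 * v * T := Real.sq_sqrt (by positivity)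
  -- The optimal Chernoff parameter: it gives `T + l² v / 2 = l s`.
  set l := s / v with hl
  have hl0 : 0 < l := by positivity
  let X : (Λ → Bool) → ι → ℝ := fun e i => ∑ α, boolSign (e α) * u i α
  have hneg : ∀ e i, Real.exp (-l * X e i) = Real.exp (-l * ∑ α, boolSign (e α) * u i α) :=
    fun _ _ => rfl
  obtain ⟨e, -, he⟩ : ∃ e ∈ (Finset.univ : Finset (Λ → Bool)),
      ∑ i, (Real.exp (l * X e i) + Real.exp (-l * X e i)) ≤
        2 * Fintype.card ι * Real.exp (l ^ 2 * v / 2) := by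
    refine Finset.exists_le_of_sum_le Finset.univ_nonempty ?_
    rw [Finset.sum_comm, Finset.sum_const, Finset.card_univ, Fintype.card_fun, Fintype.card_bool,
      nsmul_eq_mul]
    calc ∑ i, ∑ e, (Real.exp (l * X e i) + Real.exp (-l * X e i))
        ≤ ∑ _i : ι, (2 * (2 ^ Fintype.card Λ * Real.exp (l ^ 2 * v / 2))) := by
          refine Finset.sum_le_sum fun i _ => ?_
          rw [Finset.sum_add_distrib, two_mul]
          have h1 := sum_exp_rademacher_le (u i) l
          have h2 := sum_exp_rademacher_le (u i) (-l)
          rw [neg_sq] at h2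
          have h3 : (2 : ℝ) ^ Fintype.card Λ * Real.exp (l ^ 2 * (∑ α, u i α ^ 2) / 2) ≤
              2 ^ Fintype.card Λ * Real.exp (l ^ 2 * v / 2) := by
            gcongr
            exact hu i
          exact add_le_add (h1.trans h3) (h2.trans h3)
      _ = _ := by
          rw [Finset.sum_const, Finset.card_univ, nsmul_eq_mul]
          push_cast
          ring
  refine ⟨e, fun i => ?_⟩
  change |X e i| ≤ s
  have h1 : Real.exp (l * |X e i|) ≤ Real.exp (T + l ^ 2 * v / 2) := by
    rw [Real.exp_add, hT, Real.exp_log (by positivity)]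
    refine le_trans ?_ he
    refine le_trans ?_ (Finset.single_le_sum (f := fun i =>
      Real.exp (l * X e i) + Real.exp (-l * X e i)) (fun i _ => by positivity) (Finset.mem_univ i))
    rcases abs_cases (X e i) with ⟨h, _⟩ | ⟨h, _⟩ <;> rw [h]
    · linarith [Real.exp_pos (-l * X e i)]
    · rw [mul_neg, ← neg_mul]
      linarith [Real.exp_pos (l * X e i)]
  have h2 := Real.exp_le_exp.1 h1
  have h3 : T + l ^ 2 * v / 2 = l * s := by
    have : T = s ^ 2 / (2 * v) := by rw [hs2]; field_simp
    rw [this, hl]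
    field_simp
    ring
  rw [h3] at h2
  exact le_of_mul_le_mul_left h2 hl0

/-- The `N`-th roots of unity. -/
def gridPoint (N : ℕ) (k : Fin N) : ℂ := Complex.exp (Complex.I * ((2 * π * k / N : ℝ) : ℂ))

theorem norm_gridPoint (N : ℕ) (k : Fin N) : ‖gridPoint N k‖ = 1 := by
  rw [gridPoint, mul_comm, Complex.norm_exp_ofReal_mul_I]

theorem exists_gridPoint_near {N : ℕ} (hN : 0 < N) {w : ℂ} (hw : ‖w‖ = 1) :
    ∃ k, ‖w - gridPoint N k‖ ≤ 2 * π / N := by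
  have hN0 : (0 : ℝ) < N := by exact_mod_cast hN
  have hpi := Real.pi_pos
  obtain ⟨θ, hθ0, hθ1, rfl⟩ : ∃ θ : ℝ, 0 ≤ θ ∧ θ < 2 * π ∧ w = Complex.exp (Complex.I * θ) := by
    have h1 := Complex.norm_mul_exp_arg_mul_I w
    rw [hw, Complex.ofReal_one, one_mul, mul_comm] at h1
    rcases le_or_gt 0 w.arg with h | h
    · exact ⟨w.arg, h, by linarith [Complex.arg_le_pi w], h1.symm⟩
    · refine ⟨w.arg + 2 * π, by linarith [Complex.neg_pi_lt_arg w], by linarith, ?_⟩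
      push_cast
      rw [mul_add, Complex.exp_add, h1, mul_comm Complex.I, Complex.exp_two_pi_mul_I, mul_one]
  set k := ⌊θ * N / (2 * π)⌋₊ with hk
  have hx0 : 0 ≤ θ * N / (2 * π) := by positivity
  have hk1 := Nat.floor_le hx0
  have hk2 := Nat.lt_floor_add_one (θ * N / (2 * π))
  rw [← hk] at hk1 hk2
  have hkN : k < N := by
    have : θ * N / (2 * π) < N := by
      rw [div_lt_iff₀ (by positivity)]
      nlinarith
    exact_mod_cast hk1.trans_lt this
  rw [le_div_iff₀ (by positivity)] at hk1
  rw [div_lt_iff₀ (by positivity)] at hk2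
  refine ⟨⟨k, hkN⟩, ?_⟩
  have h3 : Complex.exp (Complex.I * θ) - gridPoint N ⟨k, hkN⟩ =
      gridPoint N ⟨k, hkN⟩ * (Complex.exp (Complex.I * ((θ - 2 * π * k / N : ℝ) : ℂ)) - 1) := by
    rw [mul_sub, mul_one, gridPoint, ← Complex.exp_add, ← mul_add, ← Complex.ofReal_add]
    congr 4
    ring
  rw [h3, norm_mul, norm_gridPoint, one_mul]
  refine Real.norm_exp_I_mul_ofReal_sub_one_le.trans ?_
  rw [Real.norm_eq_abs, abs_le, neg_le_sub_iff_le_add, sub_le_iff_le_add]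
  have e1 : 2 * π * k / N ≤ θ := by rw [div_le_iff₀ hN0]; linarith
  have e2 : θ ≤ 2 * π / N + 2 * π * k / N := by rw [← add_div, le_div_iff₀ hN0]; linarith
  have e3 : 0 ≤ 2 * π / N := by positivity
  exact ⟨by linarith, e2⟩

/-- A quadratic polynomial is controlled on the disk by its values at the roots of unity. -/
theorem norm_quadratic_le {N : ℕ} (hN : 6 * π < N) {c : Fin 3 → ℂ} {B : ℝ}
    (hB : ∀ k, ‖∑ m : Fin 3, c m * gridPoint N k ^ (m : ℕ)‖ ≤ B) {w : ℂ} (hw : ‖w‖ ≤ 1) :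
    ‖∑ m : Fin 3, c m * w ^ (m : ℕ)‖ ≤ (1 - 6 * π / N)⁻¹ * B := by
  have hpi := Real.pi_pos
  have hN0 : (0 : ℝ) < N := by linarith
  let p : ℂ → ℂ := fun w => ∑ m : Fin 3, c m * w ^ (m : ℕ)
  have hp : ∀ w, p w = c 0 + c 1 * w + c 2 * w ^ 2 := fun w => by simp [p, Fin.sum_univ_three]
  have hd : Differentiable ℂ p := by fun_prop
  obtain ⟨w₀, hw₀, hmax⟩ := Complex.exists_mem_frontier_isMaxOn_norm (f := p) (U := ball 0 1)
    isBounded_ball ⟨0, by simp⟩ hd.diffContOnCl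
  rw [frontier_ball _ one_ne_zero, mem_sphere_zero_iff_norm] at hw₀
  rw [closure_ball _ one_ne_zero] at hmax
  set S := ‖p w₀‖ with hS
  have hle : ∀ w : ℂ, ‖w‖ ≤ 1 → ‖p w‖ ≤ S := fun w hw => hmax (by simpa using hw)
  -- The coefficients are recovered by averaging over the square and fourth roots of unity. The
  -- derivative is then at most `3 S`, and a grid point lies within `2 π / N` of the maximum point.
  have hc1 : ‖c 1‖ ≤ S := by
    have h : c 1 = (p 1 - p (-1)) / 2 := by rw [hp, hp]; ring
    rw [h, norm_div, Complex.norm_ofNat, div_le_iff₀ two_pos]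
    linarith [norm_sub_le (p 1) (p (-1)), hle 1 (by simp), hle (-1) (by simp)]
  have hc2 : ‖c 2‖ ≤ S := by
    have h : c 2 = ((p 1 + p (-1)) - (p Complex.I + p (-Complex.I))) / 4 := by
      simp only [hp]
      ring_nf
      rw [Complex.I_sq]
      ring
    rw [h, norm_div, Complex.norm_ofNat, div_le_iff₀ (by norm_num)]
    linarith [norm_sub_le (p 1 + p (-1)) (p Complex.I + p (-Complex.I)), norm_add_le (p 1) (p (-1)),
      norm_add_le (p Complex.I) (p (-Complex.I)), hle 1 (by simp), hle (-1) (by simp),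
      hle Complex.I (by simp), hle (-Complex.I) (by simp)]
  obtain ⟨k, hk⟩ := exists_gridPoint_near (N := N) (by exact_mod_cast hN0) hw₀
  have hdiff : ‖p w₀ - p (gridPoint N k)‖ ≤ 6 * π / N * S := by
    have h : p w₀ - p (gridPoint N k) =
        (w₀ - gridPoint N k) * (c 1 + c 2 * (w₀ + gridPoint N k)) := by
      rw [hp, hp]; ring
    have h2 : ‖c 1 + c 2 * (w₀ + gridPoint N k)‖ ≤ 3 * S := by
      refine (norm_add_le _ _).trans ?_
      rw [norm_mul]
      have h3 : ‖w₀ + gridPoint N k‖ ≤ 2 := by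
        refine (norm_add_le _ _).trans ?_
        rw [hw₀, norm_gridPoint]
        norm_num
      nlinarith [norm_nonneg (c 2), norm_nonneg (w₀ + gridPoint N k)]
    rw [h, norm_mul]
    calc ‖w₀ - gridPoint N k‖ * ‖c 1 + c 2 * (w₀ + gridPoint N k)‖ ≤ 2 * π / N * (3 * S) := by
          gcongr
      _ = _ := by ring
  have h1 : 6 * π / N < 1 := (div_lt_one hN0).2 hN
  have h2 : S ≤ B + 6 * π / N * S := by
    have := norm_le_norm_add_norm_sub' (p w₀) (p (gridPoint N k))
    linarith [hB k]
  refine (hle w hw).trans ?_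
  rw [← div_eq_inv_mul, le_div_iff₀ (by linarith)]
  linarith

/-- A polynomial of degree at most two in each variable is controlled on the polydisk by its values
at the points all of whose coordinates are roots of unity. -/
theorem norm_polynomial_le_of_grid {n N : ℕ} (hN : 6 * π < N) (a : (Fin n → Fin 3) → ℂ) {B : ℝ}
    (hB : ∀ κ : Fin n → Fin N, ‖∑ α, a α * ∏ i, gridPoint N (κ i) ^ (α i : ℕ)‖ ≤ B)
    {w : Fin n → ℂ} (hw : ∀ i, ‖w i‖ ≤ 1) :
    ‖∑ α, a α * ∏ i, w i ^ (α i : ℕ)‖ ≤ ((1 - 6 * π / N)⁻¹) ^ n * B := by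
  classical
  -- Free the coordinates from the grid one at a time; each costs one factor.
  have key : ∀ (J : Finset (Fin n)) (w : Fin n → ℂ), (∀ i ∈ J, ‖w i‖ ≤ 1) →
      (∀ i ∉ J, ∃ k, w i = gridPoint N k) →
      ‖∑ α, a α * ∏ i, w i ^ (α i : ℕ)‖ ≤ ((1 - 6 * π / N)⁻¹) ^ J.card * B := by
    intro J
    induction J using Finset.induction_on with
    | empty =>
      intro w _ hw
      choose κ hκ using fun i => hw i (Finset.notMem_empty i)
      simpa [hκ] using hB κ
    | insert j J hj ih =>
      intro w hw1 hw2
      let c : Fin 3 → ℂ := fun m =>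
        ∑ α with α j = m, a α * ∏ i ∈ Finset.univ.erase j, w i ^ (α i : ℕ)
      have hc : ∀ l : ℂ, ∑ α, a α * ∏ i, Function.update w j l i ^ (α i : ℕ) =
          ∑ m : Fin 3, c m * l ^ (m : ℕ) := by
        intro l
        rw [← Finset.sum_fiberwise Finset.univ fun α : Fin n → Fin 3 => α j]
        refine Finset.sum_congr rfl fun m _ => ?_
        rw [Finset.sum_mul]
        refine Finset.sum_congr rfl fun α hα => ?_
        rw [← Finset.mul_prod_erase _ _ (Finset.mem_univ j), Function.update_self,
          (Finset.mem_filter.1 hα).2, mul_assoc, mul_comm (l ^ _)]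
        congr 2
        refine Finset.prod_congr rfl fun i hi => ?_
        rw [Function.update_of_ne (Finset.ne_of_mem_erase hi)]
      have h1 := norm_quadratic_le hN (c := c) (B := ((1 - 6 * π / N)⁻¹) ^ J.card * B)
        (fun k => by
          rw [← hc]
          refine ih _ (fun i hi => ?_) fun i hi => ?_
          · rw [Function.update_of_ne (ne_of_mem_of_not_mem hi hj)]
            exact hw1 i (Finset.mem_insert_of_mem hi)
          · rcases eq_or_ne i j with rfl | hij
            · exact ⟨k, Function.update_self _ _ _⟩
            · rw [Function.update_of_ne hij]
              exact hw2 i (by simp [hij, hi])) (hw1 j (Finset.mem_insert_self j J))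
      rw [← hc, Function.update_eq_self] at h1
      rwa [Finset.card_insert_of_notMem hj, pow_succ', mul_assoc]
  simpa using key Finset.univ w (fun i _ => hw i) (by simp)

/-- Since `6 π < 20`, the factor `40` gives `6 π / N ≤ 1 / (2 n)`; then Bernoulli's inequality. -/
theorem inv_one_sub_pow_le_two {n N : ℕ} (hn : 0 < n) (hN : N = 40 * n) :
    ((1 - 6 * π / N)⁻¹) ^ n ≤ 2 := by
  have hn0 : (0 : ℝ) < n := by exact_mod_cast hn
  have hn1 : (1 : ℝ) ≤ n := by exact_mod_cast hn
  have hpi := Real.pi_lt_d2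
  have h1 : 6 * π / N ≤ 1 / (2 * n) := by
    rw [hN]
    push_cast
    rw [div_le_div_iff₀ (by positivity) (by positivity)]
    nlinarith
  have h0 : 1 / (2 * (n : ℝ)) ≤ 1 / 2 := one_div_le_one_div_of_le two_pos (by linarith)
  have h2 := one_add_mul_le_pow (a := -(1 / (2 * (n : ℝ)))) (by linarith) n
  have h3 : 1 + (n : ℝ) * -(1 / (2 * n)) = 1 / 2 := by field_simp; ring
  rw [h3] at h2
  rw [inv_pow]
  refine inv_le_of_inv_le₀ two_pos ?_
  rw [inv_eq_one_div]
  refine h2.trans (pow_le_pow_left₀ (by linarith) (by linarith) n)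

/-- Random polynomials with small supremum norm (a Kahane–Salem–Zygmund type inequality). -/
theorem exists_signs_norm_polynomial_le {n : ℕ} (hn : 0 < n) {c : (Fin n → Fin 3) → ℝ}
    (hc : 0 < ∑ α, c α ^ 2) :
    ∃ e : (Fin n → Fin 3) → Bool, ∀ w : Fin n → ℂ, (∀ i, ‖w i‖ ≤ 1) →
      ‖∑ α, ((boolSign (e α) * c α : ℝ) : ℂ) * ∏ i, w i ^ (α i : ℕ)‖ ≤
        4 * √(2 * (∑ α, c α ^ 2) * Real.log (4 * (40 * n) ^ n)) := by
  set N := 40 * n with hN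
  have hNpos : 0 < N := by omega
  have hn1 : (1 : ℝ) ≤ n := by exact_mod_cast hn
  have hN6 : 6 * π < N := by
    rw [hN]
    push_cast
    linarith [Real.pi_lt_d2]
  have : Nonempty (Fin N) := ⟨⟨0, hNpos⟩⟩
  let M : (Fin n → Fin N) → (Fin n → Fin 3) → ℂ := fun κ α => ∏ i, gridPoint N (κ i) ^ (α i : ℕ)
  have hM : ∀ κ α, ‖M κ α‖ = 1 := fun κ α => by simp [M, norm_prod, norm_gridPoint]
  -- Real and imaginary parts at all grid points are controlled at once. Recombining them costs a
  -- factor `2`, leaving the grid another, whence the final `4`.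
  let u : (Fin n → Fin N) × Bool → (Fin n → Fin 3) → ℝ := fun x α =>
    c α * if x.2 then (M x.1 α).re else (M x.1 α).im
  have hu : ∀ x, ∑ α, u x α ^ 2 ≤ ∑ α, c α ^ 2 := by
    intro x
    refine Finset.sum_le_sum fun α _ => ?_
    simp only [u, mul_pow]
    refine mul_le_of_le_one_right (sq_nonneg _) ?_
    rw [sq_le_one_iff_abs_le_one]
    split_ifs
    · exact (Complex.abs_re_le_norm _).trans (hM _ _).le
    · exact (Complex.abs_im_le_norm _).trans (hM _ _).le
  obtain ⟨e, he⟩ := exists_signs_abs_sum_le hc hu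
  have hcard : (2 * Fintype.card ((Fin n → Fin N) × Bool) : ℝ) = 4 * (40 * n) ^ n := by
    rw [Fintype.card_prod, Fintype.card_fun, Fintype.card_bool, Fintype.card_fin, Fintype.card_fin,
      hN]
    push_cast
    ring
  rw [hcard] at he
  refine ⟨e, fun w hw => ?_⟩
  set s := √(2 * (∑ α, c α ^ 2) * Real.log (4 * (40 * n) ^ n)) with hs
  refine (norm_polynomial_le_of_grid hN6 _ (B := 2 * s) (fun κ => ?_) hw).trans ?_
  · refine (Complex.norm_le_abs_re_add_abs_im _).trans ?_
    rw [two_mul]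
    refine add_le_add (le_of_eq_of_le ?_ (he (κ, true))) (le_of_eq_of_le ?_ (he (κ, false)))
    · rw [Complex.re_sum]
      congr 1
      refine Finset.sum_congr rfl fun α _ => ?_
      rw [Complex.re_ofReal_mul, mul_assoc]
      rfl
    · rw [Complex.im_sum]
      congr 1
      refine Finset.sum_congr rfl fun α _ => ?_
      rw [Complex.im_ofReal_mul, mul_assoc]
      rfl
  · have := inv_one_sub_pow_le_two hn hN
    have hs0 : 0 ≤ s := Real.sqrt_nonneg _
    nlinarith

end RandomPolynomial

/-! ### Bounded polynomials with large absolute sums. -/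

section LargePolynomial

/-- Greedy choice of a nearly largest remaining coordinate; `c < 1` is the loss because the suprema
need not be attained. -/
theorem exists_finset_sum_sq_ge (z : Linf) {c : ℝ} (hc0 : 0 ≤ c) (hc1 : c < 1) (n : ℕ) :
    ∃ A : Finset ℕ, A.card = n ∧
      c ^ 2 * ∑ j ∈ Finset.Icc 1 n, decRearr z j ^ 2 ≤ ∑ j ∈ A, ‖z j‖ ^ 2 := by
  induction n with
  | zero => exact ⟨∅, by simp⟩
  | succ n ih =>
    obtain ⟨A, hA, h⟩ := ih
    obtain ⟨j, hj, hlt⟩ : ∃ j ∉ A, c * decRearr z (n + 1) ≤ ‖z j‖ := by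
      rcases (decRearr_nonneg z (n + 1)).eq_or_lt with h0 | h0
      · obtain ⟨j, hj⟩ := Infinite.exists_notMem_finset A
        exact ⟨j, hj, by rw [← h0, mul_zero]; exact norm_nonneg _⟩
      · obtain ⟨j, hj⟩ := Infinite.exists_notMem_finset A
        have : Nonempty {j : ℕ // j ∉ A} := ⟨⟨j, hj⟩⟩
        have h1 : decRearr z (n + 1) ≤ ⨆ j : {j : ℕ // j ∉ A}, ‖z j‖ :=
          csInf_le (bddBelow_decRearr z (n + 1)) ⟨A, by omega, rfl⟩
        obtain ⟨i, hi⟩ := exists_lt_of_lt_ciSup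
          ((mul_lt_of_lt_one_left h0 hc1).trans_le h1)
        exact ⟨i, i.2, hi.le⟩
    refine ⟨insert j A, by rw [Finset.card_insert_of_notMem hj, hA], ?_⟩
    rw [Finset.sum_Icc_succ_top (by omega), Finset.sum_insert hj, mul_add, ← mul_pow c, add_comm]
    exact add_le_add
      (pow_le_pow_left₀ (mul_nonneg hc0 (decRearr_nonneg z _)) hlt 2) h

theorem exp_le_one_add_add_sq {y : ℝ} (h0 : 0 ≤ y) (h1 : y ≤ 1) :
    Real.exp y ≤ 1 + y + y ^ 2 := by
  have := (abs_le.1 (Real.abs_exp_sub_one_sub_id_le (by rwa [abs_of_nonneg h0]))).2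
  linarith

/-- The right side is `∏ (1 + y² + y⁴)`, and `exp x ≤ 1 + x + x²` on `[0, 1]`. Degree two in each
variable therefore already suffices. -/
theorem exp_sum_sq_le_sum_prod_sq {n : ℕ} {y : Fin n → ℝ} (h0 : ∀ i, 0 ≤ y i)
    (h1 : ∀ i, y i ≤ 1) :
    Real.exp (∑ i, y i ^ 2) ≤ ∑ α : Fin n → Fin 3, (∏ i, y i ^ (α i : ℕ)) ^ 2 := by
  have h : ∑ α : Fin n → Fin 3, (∏ i, y i ^ (α i : ℕ)) ^ 2 =
      ∏ i, (1 + y i ^ 2 + (y i ^ 2) ^ 2) := by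
    have h2 : ∀ i, 1 + y i ^ 2 + (y i ^ 2) ^ 2 = ∑ m : Fin 3, (y i ^ 2) ^ (m : ℕ) := fun i => by
      simp [Fin.sum_univ_three]
    simp only [h2]
    rw [Fintype.prod_sum]
    refine Finset.sum_congr rfl fun α _ => ?_
    rw [← Finset.prod_pow]
    refine Finset.prod_congr rfl fun i _ => ?_
    rw [← pow_mul, ← pow_mul, mul_comm]
  rw [h, Real.exp_sum]
  exact Finset.prod_le_prod (fun i _ => (Real.exp_pos _).le) fun i _ =>
    exp_le_one_add_add_sq (sq_nonneg _) (pow_le_one₀ (h0 i) (h1 i))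

theorem eventually_mul_log_le_rpow {b : ℝ} (hb : 1 < b) {D : ℝ} (hD : 0 ≤ D) :
    ∀ᶠ n : ℕ in Filter.atTop, D * Real.log (4 * (40 * n) ^ n) ≤ (n : ℝ) ^ b := by
  have h1 : (fun x : ℝ => Real.log 4 + x * Real.log 40 + x * Real.log x) =o[Filter.atTop]
      fun x => x ^ b := by
    have hlog : ∀ {r : ℝ}, 0 < r → ∀ C : ℝ, (fun _ => C) =o[Filter.atTop] fun x : ℝ => x ^ r :=
      fun hr C => isLittleO_const_log_atTop.trans (isLittleO_log_rpow_atTop hr)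
    have hmul : ∀ {g : ℝ → ℝ}, (g =o[Filter.atTop] fun x : ℝ => x ^ (b - 1)) →
        (fun x => x * g x) =o[Filter.atTop] fun x => x ^ b := fun hg => by
      refine ((Asymptotics.isBigO_refl (fun x : ℝ => x) Filter.atTop).mul_isLittleO hg).congr'
        Filter.EventuallyEq.rfl ?_
      filter_upwards [Filter.eventually_gt_atTop 0] with x hx
      rw [← Real.rpow_one_add' hx.le (by linarith)]
      congr 1
      ring
    exact ((hlog (by linarith) _).add (hmul (hlog (sub_pos.2 hb) _))).add
      (hmul (isLittleO_log_rpow_atTop (sub_pos.2 hb)))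
  have h2 := (h1.comp_tendsto tendsto_natCast_atTop_atTop).bound
    (show 0 < (D + 1)⁻¹ by positivity)
  filter_upwards [h2, Filter.eventually_gt_atTop 0] with n hn hn0
  have hn0' : (n : ℝ) ≠ 0 := by positivity
  simp only [Function.comp_apply] at hn
  rw [Real.log_mul (by norm_num) (by positivity), Real.log_pow, Real.log_mul (by norm_num) hn0']
  have h3 := (Real.le_norm_self _).trans hn
  rw [Real.norm_of_nonneg (by positivity), inv_mul_eq_div, le_div_iff₀ (by positivity)] at h3
  have h4 : 0 ≤ Real.log 4 + n * Real.log 40 + n * Real.log n := by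
    have := Real.log_nonneg (show (1 : ℝ) ≤ 4 by norm_num)
    have := Real.log_nonneg (show (1 : ℝ) ≤ 40 by norm_num)
    have := Real.log_natCast_nonneg n
    positivity
  nlinarith

theorem exists_finset_rpow_le_exp_sum_sq {z : Linf} (h : 1 < logLimsup z) :
    ∃ b : ℝ, 1 < b ∧ ∃ᶠ n in Filter.atTop,
      ∃ A : Finset ℕ, A.card = n ∧ (n : ℝ) ^ b ≤ Real.exp (∑ j ∈ A, ‖z j‖ ^ 2) := by
  obtain ⟨b, hb1, hb⟩ := EReal.lt_iff_exists_real_btwn.1 h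
  have hb1 : 1 < b := by exact_mod_cast hb1
  -- The gap between `q` and `b` pays for the greedy loss, with squared constant `q / b`.
  obtain ⟨q, hq1, hq⟩ := exists_between hb1
  have hb0 : 0 < b := by linarith
  refine ⟨q, hq1, ?_⟩
  refine ((Filter.frequently_lt_of_lt_limsup (by isBoundedDefault) hb).and_eventually
    (Filter.eventually_gt_atTop 1)).mono fun n ⟨hn, hn1⟩ => ?_
  have hn : b < 1 / Real.log n * ∑ j ∈ Finset.Icc 1 n, decRearr z j ^ 2 := by exact_mod_cast hn
  have hlog : 0 < Real.log n := Real.log_pos (by exact_mod_cast hn1)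
  rw [one_div, inv_mul_eq_div, lt_div_iff₀ hlog] at hn
  obtain ⟨A, hA, hs⟩ := exists_finset_sum_sq_ge z (Real.sqrt_nonneg (q / b))
    ((Real.sqrt_lt' one_pos).2 (by rw [one_pow, div_lt_one hb0]; exact hq)) n
  refine ⟨A, hA, ?_⟩
  rw [Real.rpow_def_of_pos (by positivity), Real.exp_le_exp]
  rw [Real.sq_sqrt (by positivity)] at hs
  refine le_trans ?_ hs
  calc Real.log n * q = q / b * (b * Real.log n) := by field_simp
    _ ≤ _ := by gcongr

/-- If `1 < logLimsup z`, there are polynomials, bounded by one on the polydisk, whose monomial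
series has arbitrarily large absolute sums at `z`. -/
theorem exists_polynomial_sum_norm_ge {z : Linf} (hz : ∀ j, ‖z j‖ ≤ 1) (h : 1 < logLimsup z)
    (D : ℝ) :
    ∃ (n : ℕ) (j : Fin n → ℕ) (a : (Fin n → Fin 3) → ℂ), Function.Injective j ∧
      (∀ w : Fin n → ℂ, (∀ i, ‖w i‖ ≤ 1) → ‖∑ α, a α * ∏ i, w i ^ (α i : ℕ)‖ ≤ 1) ∧
      (∀ α, ‖a α‖ ≤ 1) ∧ D ≤ ∑ α, ‖a α‖ * ∏ i, ‖z (j i)‖ ^ (α i : ℕ) := by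
  obtain ⟨b, hb, hfreq⟩ := exists_finset_rpow_le_exp_sum_sq h
  obtain ⟨n, ⟨⟨A, hA, hsum⟩, hlog⟩, hn⟩ := ((hfreq.and_eventually
    (eventually_mul_log_le_rpow hb (show 0 ≤ 32 * D ^ 2 by positivity))).and_eventually
    (Filter.eventually_gt_atTop 0)).exists
  let j : Fin n → ℕ := A.orderEmbOfFin hA
  have hj : Function.Injective j := (A.orderEmbOfFin hA).injective
  have hsumj : ∑ i, ‖z (j i)‖ ^ 2 = ∑ j ∈ A, ‖z j‖ ^ 2 := by
    rw [← Finset.image_orderEmbOfFin_univ A hA, Finset.sum_image fun x _ y _ hxy => hj hxy]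
  let c : (Fin n → Fin 3) → ℝ := fun α => ∏ i, ‖z (j i)‖ ^ (α i : ℕ)
  have hc0 : ∀ α, 0 ≤ c α := fun α => by positivity
  set V := ∑ α, c α ^ 2 with hV
  set L := Real.log (4 * (40 * n) ^ n) with hL
  have hVexp : Real.exp (∑ j ∈ A, ‖z j‖ ^ 2) ≤ V := by
    rw [← hsumj]
    exact exp_sum_sq_le_sum_prod_sq (fun i => norm_nonneg _) fun i => hz _
  have hV0 : 0 < V := (Real.exp_pos _).trans_le hVexp
  have hL1 : 1 ≤ L := by
    rw [hL, Real.le_log_iff_exp_le (by positivity)]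
    have h1 : (1 : ℝ) ≤ (40 * n) ^ n := one_le_pow₀ (by
      have : (1 : ℝ) ≤ n := by exact_mod_cast hn
      linarith)
    linarith [Real.exp_one_lt_d9]
  -- The random bound. After division by it the absolute sum at `z` is `V / B`, which is at least
  -- `D` once `V ≥ 32 D² L`.
  set B := 4 * √(2 * V * L) with hB
  have hB0 : 0 < B := by positivity
  have hBsq : B ^ 2 = 32 * V * L := by
    rw [hB, mul_pow, Real.sq_sqrt (by positivity)]
    ring
  obtain ⟨e, he⟩ := exists_signs_norm_polynomial_le hn hV0
  have hnorm : ∀ α, ‖((boolSign (e α) * c α / B : ℝ) : ℂ)‖ = c α / B := fun α => by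
    rw [Complex.norm_real, norm_div, norm_mul, Real.norm_eq_abs, abs_boolSign, one_mul,
      Real.norm_of_nonneg (hc0 α), Real.norm_of_nonneg hB0.le]
  refine ⟨n, j, fun α => ((boolSign (e α) * c α / B : ℝ) : ℂ), hj, fun w hw => ?_, fun α => ?_, ?_⟩
  · have h1 : ∑ α, ((boolSign (e α) * c α / B : ℝ) : ℂ) * ∏ i, w i ^ (α i : ℕ) =
        (∑ α, ((boolSign (e α) * c α : ℝ) : ℂ) * ∏ i, w i ^ (α i : ℕ)) / B := by
      rw [Finset.sum_div]
      refine Finset.sum_congr rfl fun α _ => ?_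
      rw [Complex.ofReal_div]
      ring
    rw [h1, norm_div, Complex.norm_real, Real.norm_of_nonneg hB0.le, div_le_one hB0]
    exact he w hw
  · rw [hnorm, div_le_one hB0]
    refine abs_le_of_sq_le_sq' ?_ hB0.le |>.2
    have : c α ^ 2 ≤ V := Finset.single_le_sum (fun β _ => sq_nonneg (c β)) (Finset.mem_univ α)
    rw [hBsq]
    nlinarith
  · simp only [hnorm]
    have h1 : ∑ α, c α / B * c α = V / B := by
      rw [hV, Finset.sum_div]
      exact Finset.sum_congr rfl fun α _ => by ring
    change D ≤ ∑ α, c α / B * c α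
    rw [h1, le_div_iff₀ hB0]
    refine abs_le_of_sq_le_sq' ?_ hV0.le |>.2
    rw [mul_pow, hBsq]
    have h2 : 32 * D ^ 2 * L ≤ V := hlog.trans (hsum.trans hVexp)
    nlinarith

end LargePolynomial

/-! ### Gluing the polynomials into a counterexample; the necessary condition. -/

section Necessity

theorem norm_apply_lt_one {z : Linf} (hz : z ∈ polydisk) (j : ℕ) : ‖z j‖ < 1 :=
  (lp.norm_apply_le_norm (by simp) z j).trans_lt (mem_ball_zero_iff.1 hz)

theorem differentiable_coord (j : ℕ) : Differentiable ℂ fun z : Linf => z j :=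
  (lp.evalCLM ℂ (fun _ : ℕ => ℂ) ∞ j).differentiable

theorem differentiable_monomial (α : ℕ →₀ ℕ) : Differentiable ℂ fun z => monomial z α := by
  unfold monomial Finsupp.prod
  exact fun z => (HasFDerivAt.finsetProd (g := fun j (z : Linf) => z j ^ α j) fun j _ =>
    ((differentiable_coord j).fun_pow (α j) z).hasFDerivAt).differentiableAt

/-- A normally convergent series of holomorphic functions on the polydisk belongs to `H_∞`. -/
theorem isHInfty_tsum {f : ℕ → Linf → ℂ} {u : ℕ → ℝ} (hu : Summable u)
    (hd : ∀ k, DifferentiableOn ℂ (f k) polydisk) (hb : ∀ k, ∀ z ∈ polydisk, ‖f k z‖ ≤ u k) :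
    IsHInfty fun z => ∑' k, f k z := by
  have hsum : ∀ z ∈ polydisk, Summable fun k => ‖f k z‖ := fun z hz =>
    Summable.of_nonneg_of_le (fun _ => norm_nonneg _) (fun k => hb k z hz) hu
  refine ⟨fun x hx => ?_, ∑' k, u k, fun z hz => ?_⟩
  · have hx1 : 0 < 1 - ‖x‖ := sub_pos.2 (mem_ball_zero_iff.1 hx)
    set r := (1 - ‖x‖) / 2 with hr
    have hr0 : 0 < r := by positivity
    have hsub : ∀ y ∈ ball x r, ball y r ⊆ polydisk := fun y hy =>
      ball_subset_ball' (by
        have h1 := mem_ball.1 hy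
        have h2 := dist_triangle y x 0
        rw [dist_zero_right x] at h2
        linarith)
    have hmem : ∀ y ∈ ball x r, y ∈ polydisk := fun y hy => hsub y hy (mem_ball_self hr0)
    -- Around points of `ball x r` the ball of radius `r` stays in the polydisk. There `f k` varies
    -- by at most `2 u k`, so the Schwarz lemma bounds its derivative by `2 u k / r`.
    refine (hasFDerivAt_tsum_of_isPreconnected (u := fun k => 2 * u k / r)
      (f' := fun k y => fderiv ℂ (f k) y) (x₀ := x)
      ((hu.mul_left 2).div_const r) isOpen_ball (convex_ball x r).isPreconnected
      (fun k y hy => ?_) (fun k y hy => ?_) (mem_ball_self hr0)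
      (hsum x hx).of_norm (mem_ball_self hr0)).differentiableAt.differentiableWithinAt
    · exact ((hd k).differentiableAt (isOpen_ball.mem_nhds (hmem y hy))).hasFDerivAt
    · refine Complex.norm_fderiv_le_div_of_mapsTo_ball ((hd k).mono (hsub y hy))
        (fun w hw => ?_) hr0
      rw [mem_closedBall, dist_eq_norm]
      have h1 := hb k w (hsub y hy hw)
      have h2 := hb k y (hmem y hy)
      linarith [norm_sub_le (f k w) (f k y)]
  · exact (norm_tsum_le_tsum_norm (hsum z hz)).trans
      ((hsum z hz).tsum_le_tsum (fun k => hb k z hz) hu)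

theorem summable_norm_monomial_embed {n : ℕ} {w : Fin n → ℂ} (hw : ∀ i, ‖w i‖ < 1) :
    Summable fun α => ‖monomial (embed n w) α‖ := by
  rw [← (extendIndex_injective n).summable_iff fun α hα => by
    rw [monomial_embed_eq_zero_of_notMem_range w hα, norm_zero]]
  simpa only [Function.comp_def, monomial_embed_extendIndex] using (hasSum_prod_pow hw).1

theorem monomialCoeff_eq_of_hasSum_comp {ι : Type*} {φ : ι → ℕ →₀ ℕ}
    (hφ : Function.Injective φ) {a : ι → ℂ} (ha : ∀ p, ‖a p‖ ≤ 1) {f : Linf → ℂ}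
    (hf : ∀ (k : ℕ) (w : Fin k → ℂ), (∀ i, ‖w i‖ = 1 / 2) →
      HasSum (fun p => a p * monomial (embed k w) (φ p)) (f (embed k w))) (p : ι) :
    monomialCoeff f (φ p) = a p := by
  have hext : ∀ q, Function.extend φ a 0 (φ q) = a q := hφ.extend_apply a 0
  have hext0 : ∀ α ∉ Set.range φ, Function.extend φ a 0 α = 0 := fun α hα =>
    Function.extend_apply' _ _ _ hα
  rw [← hext p]
  refine cauchyCoeff_eq_of_hasSum ?_ (fun w hw => ?_) le_rfl
  · refine Summable.of_nonneg_of_le (fun _ => norm_nonneg _) (fun α => ?_)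
      (summable_norm_monomial_embed (n := length (φ p)) (w := fun _ => 1 / 2) fun _ => by norm_num)
    rw [norm_mul]
    refine mul_le_of_le_one_left (norm_nonneg _) ?_
    by_cases hα : α ∈ Set.range φ
    · obtain ⟨q, rfl⟩ := hα
      rw [hext]
      exact ha q
    · rw [hext0 α hα, norm_zero]
      exact zero_le_one
  · rw [← hφ.hasSum_iff fun α hα => by rw [hext0 α hα, zero_mul]]
    simpa only [Function.comp_def, hext] using hf _ w hw

/-- The exponent of the monomial `z_l ^ (3 k) * ∏ i, z_{j i} ^ (α i)`. -/
def blockIndex (l k : ℕ) {n : ℕ} (j : Fin n → ℕ) (α : Fin n → Fin 3) : ℕ →₀ ℕ :=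
  Finsupp.single l (3 * k) +
    (Finsupp.equivFunOnFinite.symm fun i => (α i : ℕ)).mapDomain j

theorem monomial_blockIndex (z : Linf) (l k : ℕ) {n : ℕ} (j : Fin n → ℕ)
    (α : Fin n → Fin 3) :
    monomial z (blockIndex l k j α) = z l ^ (3 * k) * ∏ i, z (j i) ^ (α i : ℕ) := by
  rw [monomial, blockIndex, Finsupp.prod_add_index' (by simp) (fun _ _ _ => pow_add _ _ _),
    Finsupp.prod_single_index (by simp), Finsupp.prod_mapDomain_index (by simp)
      (fun _ _ _ => pow_add _ _ _), Finsupp.prod_fintype _ _ (by simp)]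
  rfl

/-- The block contributes at most `2` to the exponent of `z l`, even when `l` is one of its
variables, so division by `3` recovers `k`. Different blocks thus share no monomial. -/
theorem blockIndex_apply_div (l k : ℕ) {n : ℕ} {j : Fin n → ℕ} (hj : Function.Injective j)
    (α : Fin n → Fin 3) : blockIndex l k j α l / 3 = k := by
  rw [blockIndex, Finsupp.add_apply, Finsupp.single_eq_same]
  by_cases h : l ∈ Set.range j
  · obtain ⟨i, rfl⟩ := h
    rw [Finsupp.mapDomain_apply hj]
    have := (α i).2
    simp only [Finsupp.equivFunOnFinite_symm_apply_apply]
    omega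
  · rw [Finsupp.mapDomain_of_notMem_range _ _ h]
    omega

theorem blockIndex_injective (l : ℕ) {n : ℕ → ℕ} {j : ∀ k, Fin (n k) → ℕ}
    (hj : ∀ k, Function.Injective (j k)) :
    Function.Injective fun p : Σ k, Fin (n k) → Fin 3 => blockIndex l p.1 (j p.1) p.2 := by
  rintro ⟨k, α⟩ ⟨m, β⟩ h
  have hkm : k = m := by
    rw [← blockIndex_apply_div l k (hj k) α, ← blockIndex_apply_div l m (hj m) β]
    exact congrArg (fun γ : ℕ →₀ ℕ => γ l / 3) h
  subst hkm
  have h1 := Finsupp.equivFunOnFinite.symm.injective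
    (Finsupp.mapDomain_injective (hj k) (add_left_cancel h))
  congr 1
  funext i
  exact Fin.ext (congrFun h1 i)

theorem exists_apply_ne_zero {z : Linf} (h : 1 < logLimsup z) : ∃ l, z l ≠ 0 := by
  by_contra! h0
  obtain ⟨b, hb, hfreq⟩ := exists_finset_rpow_le_exp_sum_sq h
  obtain ⟨n, ⟨A, -, hA⟩, hn⟩ := (hfreq.and_eventually (Filter.eventually_gt_atTop 1)).exists
  simp only [h0, norm_zero, ne_eq, OfNat.ofNat_ne_zero, not_false_eq_true, zero_pow,
    Finset.sum_const_zero, Real.exp_zero] at hA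
  exact hA.not_gt (Real.one_lt_rpow (by exact_mod_cast hn) (by linarith))

/-- Condensation of singularities: one function in `H_∞` collects polynomials of growing absolute
sum at `z`, with disjoint sets of monomials so that nothing cancels. -/
theorem logLimsup_le_one_of_mem {z : Linf} (hz : z ∈ monHInfty) : logLimsup z ≤ 1 := by
  by_contra! h
  obtain ⟨l, hl⟩ := exists_apply_ne_zero h
  have hl0 : 0 < ‖z l‖ := norm_pos_iff.2 hl
  -- The target compensates the later factor `2^{-k} z_l^{3k}`, so that block `k` contributes at
  -- least `1` to the absolute sum at `z`.
  choose n j a hj hbound ha hlarge using fun k : ℕ =>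
    exists_polynomial_sum_norm_ge (fun j => (norm_apply_lt_one hz.1 j).le) h
      ((1 / 2) ^ k * ‖z l‖ ^ (3 * k))⁻¹
  let φ : (Σ k, Fin (n k) → Fin 3) → ℕ →₀ ℕ := fun p => blockIndex l p.1 (j p.1) p.2
  have hφ : Function.Injective φ := blockIndex_injective l hj
  let A : (Σ k, Fin (n k) → Fin 3) → ℂ := fun p => (1 / 2) ^ p.1 * a p.1 p.2
  have hA : ∀ p, ‖A p‖ ≤ 1 := fun p => by
    simp only [A, norm_mul, norm_pow, norm_div, norm_one, Complex.norm_ofNat]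
    exact mul_le_one₀ (pow_le_one₀ (by norm_num) (by norm_num)) (norm_nonneg _) (ha _ _)
  let Q : ℕ → Linf → ℂ := fun k w => ∑ α, A ⟨k, α⟩ * monomial w (φ ⟨k, α⟩)
  have hQ : ∀ k w, Q k w = (1 / 2) ^ k * w l ^ (3 * k) *
      ∑ α, a k α * ∏ i, w (j k i) ^ (α i : ℕ) := fun k w => by
    simp only [Q, A, φ, monomial_blockIndex, Finset.mul_sum]
    exact Finset.sum_congr rfl fun α _ => by ring
  have hQb : ∀ k, ∀ w ∈ polydisk, ‖Q k w‖ ≤ (1 / 2) ^ k := fun k w hw => by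
    rw [hQ, norm_mul, norm_mul, norm_pow, norm_pow, norm_div, norm_one, Complex.norm_ofNat,
      mul_assoc]
    refine mul_le_of_le_one_right (by positivity) ?_
    exact mul_le_one₀ (pow_le_one₀ (norm_nonneg _) (norm_apply_lt_one hw l).le) (norm_nonneg _)
      (hbound k _ fun i => (norm_apply_lt_one hw _).le)
  have hf : IsHInfty fun w => ∑' k, Q k w :=
    isHInfty_tsum summable_geometric_two
      (fun k => (Differentiable.fun_sum fun α _ =>
        (differentiable_monomial (φ ⟨k, α⟩)).const_mul (A ⟨k, α⟩)).differentiableOn) hQb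
  have hcoeff : ∀ p, monomialCoeff (fun w => ∑' k, Q k w) (φ p) = A p := by
    refine monomialCoeff_eq_of_hasSum_comp hφ hA fun k w hw => ?_
    have hs : Summable fun p => A p * monomial (embed k w) (φ p) := by
      refine Summable.of_norm (Summable.of_nonneg_of_le (fun _ => norm_nonneg _) (fun p => ?_)
        ((summable_norm_monomial_embed (w := w) fun i => by rw [hw i]; norm_num).comp_injective hφ))
      rw [norm_mul]
      exact mul_le_of_le_one_left (norm_nonneg _) (hA p)
    have := hs.hasSum
    rw [hs.tsum_sigma] at this
    simpa only [tsum_fintype] using this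
  -- Absolute convergence would force the block sums to tend to zero, although each is at least one.
  have hsum := ((hz.2 _ hf).1.comp_injective hφ).sigma.tendsto_atTop_zero
  refine absurd (ge_of_tendsto' hsum fun k => ?_) (not_le.2 (one_pos (α := ℝ)))
  have hpos : 0 < (1 / 2 : ℝ) ^ k * ‖z l‖ ^ (3 * k) := by positivity
  have h1 := mul_le_mul_of_nonneg_left (hlarge k) hpos.le
  rw [mul_inv_cancel₀ hpos.ne'] at h1
  refine h1.trans_eq ?_
  rw [tsum_fintype, Finset.mul_sum]
  refine Finset.sum_congr rfl fun α _ => ?_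
  rw [Function.comp_apply, hcoeff]
  simp only [A, φ, monomial_blockIndex, norm_mul, norm_pow, norm_prod, norm_div, norm_one,
    Complex.norm_ofNat]
  ring

end Necessity

end MonConv

end

theorem theorem3p1 (z : MonConv.Linf) (hz : z ∈ MonConv.polydisk) :
    (MonConv.logLimsup z < ((1 / 2 : ℝ) : EReal) → z ∈ MonConv.monHInfty) ∧
    (z ∈ MonConv.monHInfty → MonConv.logLimsup z ≤ 1) :=
  ⟨MonConv.mem_monHInfty_of_logLimsup_lt hz, MonConv.logLimsup_le_one_of_mem⟩
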